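/- Let $\mathbb{R}_\infty=[0,\infty]$ be the complete commutative semiring of nonnegative reals with $\infty$ ($0\cdot\infty=0$, arbitrary sums allowed). Let $\mathcal{P}$ be the traced prop whose morphisms $n\to m$ are the $\mathbb{R}_\infty$-linear maps (compatible with arbitrary infinite sums) $\mathbb{R}_\infty[[X_1,\dots,X_n]]\to\mathbb{R}_\infty[[X_1,\dots,X_m]]$, with composition of maps, the tensor product determined by $(f\otimes g)(P\otimes Q)=f(P)\otimes g(Q)$ where $(P\otimes Q)(X_1,\dots,X_{n+m})=P(X_1,\dots,X_n)\,Q(X_{n+1},\dots,X_{n+m})$, the symmetry $X^a\otimes X^b\mapsto X^b\otimes X^a$, and the trace that feeds the first output back into the first input: if $f(d,e)$ denotes the coefficient of $X^{e}$ in $f(X^{d})$, then $(\mathrm{tr} f)(d,e)=\sum_{k\ge0} f((k,d),(k,e))$. A morphism $0\to0$ is identified with a scalar in $\mathbb{R}_\infty$. In $\mathcal{P}$ consider the binomial bialgebra $\mu(X^a\otimes X^b)=X^{a+b}$, $\eta=1$, $\Delta(X^k)=\sum_j\binom{k}{j}X^j\otimes X^{k-j}$, $\epsilon(X^k)=\delta_{0,k}$,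 and, for $\lambda\in\mathbb{R}_\infty$, the endomorphism $h_\lambda(X^k)=(\lambda X)^k$. Let $\mathrm{Mat}(\mathbb{Z}_+[t])$ be the prop whose morphisms $n\to m$ are the $m\times n$ matrices over $\mathbb{Z}_+[t]$, with matrix product as composition and direct sum as tensor product. It has the morphisms $\begin{pmatrix}1&1\end{pmatrix}:2\to1$, the empty matrix $0\to 1$, $\begin{pmatrix}1\\1\end{pmatrix}:1\to2$, the empty matrix $1\to0$, and $(t):1\to1$. Theorem. (1) For every $\lambda\in\mathbb{R}_\infty$ there is exactly one prop functor $F_\lambda:\mathrm{Mat}(\mathbb{Z}_+[t])\to\mathcal{P}$ sending these five morphisms to $\mu,\eta,\Delta,\epsilon,h_\lambda$ respectively. For a square matrix $M$ of size $n$ with nonnegative integer entries, its interpretation is the scalar $\psi_\lambda(M)=\mathrm{tr}_n(F_\lambda(tM))$, where $\mathrm{tr}_n$ is the $n$-fold trace. (2) Let $\zeta_M(t)=\exp\left(\sum_{k\ge1}\frac{p_k}{k}t^k\right)$ be the (Bowen–Lanford) zeta function of the shift of finite type defined by $M$: $p_k$ is the number of bi-infinite walks $x$ with $\sigma^k x=x$,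 where $\sigma$ is the shift map, in the multigraph with $M_{ij}$ edges from $i$ to $j$. Then, as formal power series, $\zeta_M(t)=1/\det(I-tM)$; its coefficients $c_k$ are nonnegative; and for every $\lambda\in\mathbb{R}_\infty$ $$\psi_\lambda(M)=\sum_{k\ge0}c_k\lambda^k=\zeta_M(\lambda)\quad\text{in }\mathbb{R}_\infty .$$ In particular, if $\lambda<\infty$ and $\lambda\,\rho(M)<1$, where $\rho(M)$ is the spectral radius, then $\det(I-\lambda M)>0$ and $\psi_\lambda(M)=1/\det(I-\lambda M)$. (3) The zeta function is an invariant of strong shift equivalence: if square matrices $M,N$ over $\mathbb{Z}_+$, possibly of different sizes, are related by the smallest equivalence relation such that $RS\equiv SR$ for all (possibly nonsquare) matrices $R,S$ over $\mathbb{Z}_+$, then $\zeta_M=\zeta_N$. -/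

import Mathlib

open scoped ENNReal NNReal Polynomial

noncomputable section

namespace BinomialProp

/-! ### The prop of complete-linear maps between power series over `[0, ∞]` -/

/-- The `n`-th tensor power of `V = [0,∞]⟦X⟧`: formal power series in `n` variables with coefficients
in the complete semiring `[0, ∞]`. -/
abbrev V (n : ℕ) : Type := MvPowerSeries (Fin n) ℝ≥0∞

/-- The monomial `X₁ ^ e₁ ⋯ Xₙ ^ eₙ`. -/
def mono {n : ℕ} (e : Fin n →₀ ℕ) : V n := MvPowerSeries.monomial e 1

/-- The sum of an arbitrary family of power series (every sum exists in `[0, ∞]`, and sums of power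
series are computed coefficientwise). -/
def infSum {n : ℕ} {ι : Type} (P : ι → V n) : V n :=
  fun e => ∑' i, MvPowerSeries.coeff e (P i)

/-- Arrows `n ⟶ m`: the maps from power series in `n` variables to power series in `m` variables that
are linear over the complete semiring `[0, ∞]`, that is, linear and compatible with infinite
sums. -/
@[ext]
structure Arrow (n m : ℕ) where
  toLin : V n →ₗ[ℝ≥0∞] V m
  map_infSum : ∀ (ι : Type) (P : ι → V n), toLin (infSum P) = infSum fun i => toLin (P i)

/-- The unique arrow with prescribed values `b e` on the monomials `X ^ e`. -/
def ofMono {n m : ℕ} (b : (Fin n →₀ ℕ) → V m) : Arrow n m where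
  toLin :=
    { toFun := fun P d => ∑' e, MvPowerSeries.coeff e P * MvPowerSeries.coeff d (b e)
      map_add' := by
        intro P Q
        funext d
        simp only [map_add, add_mul]
        exact ENNReal.tsum_add
      map_smul' := by
        intro c P
        funext d
        simp only [map_smul, smul_eq_mul, mul_assoc, RingHom.id_apply]
        exact ENNReal.tsum_mul_left }
  map_infSum := by
    intro ι P
    funext d
    change (∑' e, (∑' i, MvPowerSeries.coeff e (P i)) * MvPowerSeries.coeff d (b e)) =
      ∑' i, ∑' e, MvPowerSeries.coeff e (P i) * MvPowerSeries.coeff d (b e)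
    rw [ENNReal.tsum_comm]
    exact tsum_congr fun e => ENNReal.tsum_mul_right.symm

theorem ofMono_mono {n m : ℕ} (b : (Fin n →₀ ℕ) → V m) (e : Fin n →₀ ℕ) :
    (ofMono b).toLin (mono e) = b e := by
  classical
  funext d
  change (∑' e', MvPowerSeries.coeff e' (mono e) * MvPowerSeries.coeff d (b e')) = _
  rw [tsum_eq_single e]
  · simp only [mono, MvPowerSeries.coeff_monomial_same, one_mul]
    rfl
  · intro e' he
    simp [mono, MvPowerSeries.coeff_monomial, he]

/-- Identity arrows; `ident 0` is the empty morphism and `ident 1` the single wire. -/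
def ident (n : ℕ) : Arrow n n := ⟨LinearMap.id, fun _ _ => rfl⟩

/-- Sequential composition `g ∘ f`. -/
def comp {n m k : ℕ} (g : Arrow m k) (f : Arrow n m) : Arrow n k where
  toLin := g.toLin ∘ₗ f.toLin
  map_infSum := fun ι P => by
    simp only [LinearMap.comp_apply, f.map_infSum, g.map_infSum]

/-- Exponents of the first `n` variables. -/
def leftExp {n m : ℕ} (e : Fin (n + m) →₀ ℕ) : Fin n →₀ ℕ :=
  Finsupp.equivFunOnFinite.symm fun i => e (Fin.castAdd m i)

/-- Exponents of the last `m` variables. -/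
def rightExp {n m : ℕ} (e : Fin (n + m) →₀ ℕ) : Fin m →₀ ℕ :=
  Finsupp.equivFunOnFinite.symm fun i => e (Fin.natAdd n i)

/-- `(P ⊗ Q)(X₁, …, Xₙ₊ₘ) = P(X₁, …, Xₙ) Q(Xₙ₊₁, …, Xₙ₊ₘ)`, written on coefficients. -/
def tensorV {n m : ℕ} (P : V n) (Q : V m) : V (n + m) :=
  fun e => MvPowerSeries.coeff (leftExp e) P * MvPowerSeries.coeff (rightExp e) Q

/-- Parallel composition: `(f ⊗ g)(X ^ a ⊗ X ^ b) = f(X ^ a) ⊗ g(X ^ b)`. -/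
def tensor {n m n' m' : ℕ} (f : Arrow n m) (g : Arrow n' m') : Arrow (n + n') (m + m') :=
  ofMono fun e => tensorV (f.toLin (mono (leftExp e))) (g.toLin (mono (rightExp e)))

/-- The symmetry `X ^ a ⊗ X ^ b ↦ X ^ b ⊗ X ^ a`. -/
def symmetry : Arrow 2 2 :=
  ofMono fun e => mono (Finsupp.equivFunOnFinite.symm ![e 1, e 0])

/-- The image of `X ^ e` under the trace of `f`: its coefficient at `d` is `∑ₖ f((k, e), (k, d))`, where
`f(a, b)` is the coefficient of `X ^ b` in `f(X ^ a)`. -/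
def traceV {n m : ℕ} (f : Arrow (n + 1) (m + 1)) (e : Fin n →₀ ℕ) : V m :=
  fun d => ∑' k : ℕ, MvPowerSeries.coeff (Finsupp.cons k d) (f.toLin (mono (Finsupp.cons k e)))

/-- The trace, which feeds the first output back to the first input. -/
def trace {n m : ℕ} (f : Arrow (n + 1) (m + 1)) : Arrow n m := ofMono (traceV f)

/-- The `n`-fold iterated trace of an arrow `n ⟶ n`. -/
def traceAll : (n : ℕ) → Arrow n n → Arrow 0 0
  | 0, f => f
  | n + 1, f => traceAll n (trace f)

/-- Power series in no variables are scalars, and an arrow `0 ⟶ 0` is multiplication by the scalar that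
is its value at `1`. -/
def scalar (f : Arrow 0 0) : ℝ≥0∞ := MvPowerSeries.constantCoeff (f.toLin 1)

/-! ### The binomial bialgebra -/

/-- The element `X ^ k` of `V 1`. -/
def pow (k : ℕ) : V 1 := mono (Finsupp.single 0 k)

/-- Multiplication, `X ^ a ⊗ X ^ b ↦ X ^ (a + b)`. -/
def mul : Arrow 2 1 := ofMono fun e => pow (e 0 + e 1)

/-- The unit, `1 ↦ 1`. -/
def unit : Arrow 0 1 := ofMono fun _ => pow 0

/-- Comultiplication, `X ^ k ↦ ∑ⱼ (k choose j) X ^ j ⊗ X ^ (k - j)`. -/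
def comul : Arrow 1 2 :=
  ofMono fun e => ∑ j ∈ Finset.range (e 0 + 1),
    ((e 0).choose j : ℝ≥0∞) • tensorV (pow j) (pow (e 0 - j))

/-- The counit, `X ^ k ↦ δ₀ₖ`. -/
def counit : Arrow 1 0 := ofMono fun e => if e 0 = 0 then 1 else 0

/-- The distinguished endomorphism `X ^ k ↦ (λ X) ^ k`. -/
def scale (lam : ℝ≥0∞) : Arrow 1 1 := ofMono fun e => (lam ^ e 0) • pow (e 0)

/-! ### Matrices over `ℕ[t]` and their interpretation -/

/-- Direct sum of matrices, the tensor product of the prop of matrices. -/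
def directSum {n m n' m' : ℕ} (A : Matrix (Fin m) (Fin n) ℕ[X]) (B : Matrix (Fin m') (Fin n') ℕ[X]) :
    Matrix (Fin (m + m')) (Fin (n + n')) ℕ[X] :=
  Matrix.reindex finSumFinEquiv finSumFinEquiv (Matrix.fromBlocks A 0 0 B)

/-- Prop functors from the prop of matrices over `ℕ[t]`, in which the morphisms `n ⟶ m` are the
`m × n` matrices, composition is the matrix product and the tensor product is the direct sum, to the
prop of power series. -/
@[ext]
structure PropFunctor where
  map : ∀ {n m : ℕ}, Matrix (Fin m) (Fin n) ℕ[X] → Arrow n m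
  map_comp : ∀ {n m k : ℕ} (B : Matrix (Fin k) (Fin m) ℕ[X]) (A : Matrix (Fin m) (Fin n) ℕ[X]),
    map (B * A) = comp (map B) (map A)
  map_tensor : ∀ {n m n' m' : ℕ} (A : Matrix (Fin m) (Fin n) ℕ[X])
    (B : Matrix (Fin m') (Fin n') ℕ[X]), map (directSum A B) = tensor (map A) (map B)
  map_empty : map (1 : Matrix (Fin 0) (Fin 0) ℕ[X]) = ident 0
  map_ident : map (1 : Matrix (Fin 1) (Fin 1) ℕ[X]) = ident 1
  map_symm : map (!![0, 1; 1, 0] : Matrix (Fin 2) (Fin 2) ℕ[X]) = symmetry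

/-- The functor interprets matrices in the binomial bialgebra with distinguished endomorphism
`X ^ k ↦ (λ X) ^ k`: the generators `μ, η, Δ, ε, h` of the prop of matrices over `ℕ[t]` go to the
corresponding arrows. -/
structure PropFunctor.IsBinomial (F : PropFunctor) (lam : ℝ≥0∞) : Prop where
  map_mul : F.map (!![1, 1] : Matrix (Fin 1) (Fin 2) ℕ[X]) = mul
  map_unit : F.map (0 : Matrix (Fin 1) (Fin 0) ℕ[X]) = unit
  map_comul : F.map (!![1; 1] : Matrix (Fin 2) (Fin 1) ℕ[X]) = comul
  map_counit : F.map (0 : Matrix (Fin 0) (Fin 1) ℕ[X]) = counit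
  map_scale : F.map (!![Polynomial.X] : Matrix (Fin 1) (Fin 1) ℕ[X]) = scale lam

/-- The morphism `t M` of the prop of matrices over `ℕ[t]`: every wire carries the distinguished
endomorphism. -/
def tMatrix {n : ℕ} (M : Matrix (Fin n) (Fin n) ℕ) : Matrix (Fin n) (Fin n) ℕ[X] :=
  (Polynomial.X : ℕ[X]) • M.map Polynomial.C

/-- The scalar `tr_n (F (t M))` obtained by interpreting the matrix `M`, all outputs being linked
back to the inputs. -/
def PropFunctor.interpret (F : PropFunctor) {n : ℕ} (M : Matrix (Fin n) (Fin n) ℕ) : ℝ≥0∞ :=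
  scalar (traceAll n (F.map (tMatrix M)))

/-! ### Shifts of finite type, zeta functions and strong shift equivalence -/

/-- The edges of the directed multigraph with `M i j` edges from `i` to `j`. -/
abbrev Edge {n : ℕ} (M : Matrix (Fin n) (Fin n) ℕ) : Type :=
  Σ p : Fin n × Fin n, Fin (M p.1 p.2)

/-- The edge shift of `M`: biinfinite walks in the multigraph of `M`. -/
def edgeShift {n : ℕ} (M : Matrix (Fin n) (Fin n) ℕ) : Set (ℤ → Edge M) :=
  {x | ∀ i : ℤ, (x i).1.2 = (x (i + 1)).1.1}

/-- The shift map on biinfinite words. -/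
def shiftMap {α : Type} (x : ℤ → α) : ℤ → α := fun i => x (i + 1)

/-- The number of points `x` of the edge shift with `σ ^ k x = x`. -/
def periodicCount {n : ℕ} (M : Matrix (Fin n) (Fin n) ℕ) (k : ℕ) : ℕ :=
  Set.ncard {x ∈ edgeShift M | Function.IsPeriodicPt shiftMap k x}

/-- The zeta function `exp (∑_{k ≥ 1} p_k t ^ k / k)` of the shift, as a formal power series (the
coefficient for `k = 0` below is zero). -/
def zeta {n : ℕ} (M : Matrix (Fin n) (Fin n) ℕ) : PowerSeries ℚ :=
  (PowerSeries.exp ℚ).subst (PowerSeries.mk fun k => (periodicCount M k : ℚ) / k)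

/-- The elementary relation `R S ≈ S R`, for rectangular `R` and `S`, between square matrices over
`ℕ` of possibly different sizes. -/
inductive ElementaryEquiv :
    (Σ n : ℕ, Matrix (Fin n) (Fin n) ℕ) → (Σ n : ℕ, Matrix (Fin n) (Fin n) ℕ) → Prop
  | swap {n m : ℕ} (R : Matrix (Fin n) (Fin m) ℕ) (S : Matrix (Fin m) (Fin n) ℕ) :
      ElementaryEquiv ⟨n, R * S⟩ ⟨m, S * R⟩

/-- Strong shift equivalence: the smallest equivalence relation such that `R S ≡ S R`. -/
def StrongShiftEquiv {n m : ℕ} (M : Matrix (Fin n) (Fin n) ℕ) (N : Matrix (Fin m) (Fin m) ℕ) :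
    Prop :=
  Relation.EqvGen ElementaryEquiv ⟨n, M⟩ ⟨m, N⟩

end BinomialProp

end

noncomputable section

namespace BinomialProp

/-! ### Arrows and monomials -/

/-! A matrix `A` over `ℕ[t]` acts by linear substitution: set `t = λ` and send `X i` to `∑ j, A j i
* X j`. On monomials `μ` identifies the two variables, `Δ` is `X ↦ X + Y` (the binomial theorem) and
`h` is `X ↦ λ X`, so these substitutions form a functor of the required kind
(`substFunctor_isBinomial`). It is the only one because every matrix is built from the generators
and the symmetry by products and direct sums (`map_eq_of_isBinomial`).

The full trace of a substitution with matrix `B` is the sum over `e` of the coefficient of `X ^ e`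
in the image of `X ^ e`. The MacMahon master theorem says that this is `1 / det (1 - B)`. The proof
eliminates one variable at a time: tracing out the first variable contributes the geometric series
of `B 0 0` and replaces `B` by a Schur complement (`diagSum_succ`), exactly as Gaussian elimination
does for the determinant (`det_one_sub_succ`). Since `[0, ∞]` has no subtraction, the elimination is
run over `ℕ⟦t⟧`, which maps both to `ℚ⟦t⟧`, where the determinant lives, and to `[0, ∞]` by
evaluation at any `λ`, including `∞` (`exists_inverse_det_eq_diagSum`). Nonnegativity of the
coefficients comes for free.

On the dynamical side, `p_k = tr (M ^ k)` for `k ≥ 1` (`periodicCount_succ`), and Jacobi's formula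
gives the logarithmic derivative of `det (1 - t M)`. Hence `ζ * det (1 - t M)` has derivative `0`
and constant term `1` (`zeta_mul_det`). When `λ ρ(M) < 1`, factoring the determinant over the
eigenvalues writes its inverse as a product of absolutely convergent geometric series, so the formal
identity may be evaluated at `λ`. Strong shift equivalence reduces to `det (1 - t R S) = det (1 - t
S R)`. -/

theorem coeff_infSum {n : ℕ} {ι : Type} (P : ι → V n) (e : Fin n →₀ ℕ) :
    MvPowerSeries.coeff e (infSum P) = ∑' i, MvPowerSeries.coeff e (P i) := rfl

theorem coeff_mono {n : ℕ} (d e : Fin n →₀ ℕ) :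
    MvPowerSeries.coeff d (mono e) = if d = e then 1 else 0 := by
  classical
  simp [mono, MvPowerSeries.coeff_monomial]

/-- Combined with compatibility with infinite sums, this expansion reduces every identity of arrows
to monomials. -/
theorem eq_infSum_mono {n : ℕ} (P : V n) :
    P = infSum fun e => MvPowerSeries.coeff e P • mono e := by
  classical
  ext d
  rw [coeff_infSum, tsum_eq_single d]
  · simp [coeff_mono]
  · intro e he
    simp [coeff_mono, he.symm]

/-- Arrows are determined by their values on monomials. -/
theorem Arrow.ext_mono {n m : ℕ} {f g : Arrow n m}
    (h : ∀ e, f.toLin (mono e) = g.toLin (mono e)) : f = g := by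
  ext1
  refine LinearMap.ext fun P => ?_
  rw [eq_infSum_mono P, f.map_infSum, g.map_infSum]
  simp only [map_smul, h]

theorem mono_eq_coe {n : ℕ} (e : Fin n →₀ ℕ) :
    mono e = ((MvPolynomial.monomial e (1 : ℝ≥0∞) : MvPolynomial (Fin n) ℝ≥0∞) : V n) :=
  (MvPolynomial.coe_monomial e 1).symm

/-! ### Linear substitutions -/

/-- The substitution `X i ↦ ∑ j, B j i * X j` on polynomials. -/
def linSubst {n m : ℕ} (B : Matrix (Fin m) (Fin n) ℝ≥0∞) :
    MvPolynomial (Fin n) ℝ≥0∞ →ₐ[ℝ≥0∞] MvPolynomial (Fin m) ℝ≥0∞ :=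
  MvPolynomial.aeval fun i => ∑ j, MvPolynomial.C (B j i) * MvPolynomial.X j

theorem linSubst_X {n m : ℕ} (B : Matrix (Fin m) (Fin n) ℝ≥0∞) (i : Fin n) :
    linSubst B (MvPolynomial.X i) = ∑ j, MvPolynomial.C (B j i) * MvPolynomial.X j := by
  simp [linSubst]

theorem linSubst_monomial {n m : ℕ} (B : Matrix (Fin m) (Fin n) ℝ≥0∞) (e : Fin n →₀ ℕ) :
    linSubst B (MvPolynomial.monomial e 1) =
      ∏ i, (∑ j, MvPolynomial.C (B j i) * MvPolynomial.X j) ^ e i := by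
  rw [linSubst, MvPolynomial.aeval_monomial, map_one, one_mul, Finsupp.prod_fintype]
  simp

theorem linSubst_one (n : ℕ) : linSubst (1 : Matrix (Fin n) (Fin n) ℝ≥0∞) = AlgHom.id _ _ := by
  refine MvPolynomial.algHom_ext fun i => ?_
  rw [linSubst_X, Finset.sum_eq_single i]
  · simp
  · intro j _ hj
    simp [Matrix.one_apply_ne hj]
  · simp

/-- Columns of the matrix are the images of the variables, so composition is covariant; both sides
are algebra maps and may be compared on variables. -/
theorem linSubst_mul {n m k : ℕ} (B : Matrix (Fin k) (Fin m) ℝ≥0∞)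
    (A : Matrix (Fin m) (Fin n) ℝ≥0∞) :
    linSubst (B * A) = (linSubst B).comp (linSubst A) := by
  refine MvPolynomial.algHom_ext fun i => ?_
  simp only [AlgHom.comp_apply, linSubst_X, map_sum, map_mul, MvPolynomial.algHom_C,
    MvPolynomial.algebraMap_eq, Matrix.mul_apply, Finset.sum_mul, Finset.mul_sum]
  rw [Finset.sum_comm]
  refine Finset.sum_congr rfl fun j _ => Finset.sum_congr rfl fun l _ => ?_
  ring

/-- The arrow given by a linear substitution. -/
def substArrow {n m : ℕ} (B : Matrix (Fin m) (Fin n) ℝ≥0∞) : Arrow n m :=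
  ofMono fun e => (linSubst B (MvPolynomial.monomial e 1) : V m)

theorem substArrow_mono {n m : ℕ} (B : Matrix (Fin m) (Fin n) ℝ≥0∞) (e : Fin n →₀ ℕ) :
    (substArrow B).toLin (mono e) = (linSubst B (MvPolynomial.monomial e 1) : V m) :=
  ofMono_mono _ e

/-- Composition needs this beyond monomials, because a substitution sends a monomial to a
polynomial. -/
theorem substArrow_coe {n m : ℕ} (B : Matrix (Fin m) (Fin n) ℝ≥0∞)
    (p : MvPolynomial (Fin n) ℝ≥0∞) :
    (substArrow B).toLin (p : V n) = (linSubst B p : V m) := by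
  induction p using MvPolynomial.induction_on' with
  | monomial e a =>
    have h : MvPolynomial.monomial e a = a • MvPolynomial.monomial e (1 : ℝ≥0∞) := by
      simp [MvPolynomial.smul_monomial]
    rw [h, MvPolynomial.coe_smul, map_smul, map_smul, MvPolynomial.coe_smul, ← substArrow_mono,
      mono_eq_coe]
  | add p q hp hq => rw [MvPolynomial.coe_add, map_add, map_add, MvPolynomial.coe_add, hp, hq]

theorem substArrow_one (n : ℕ) : substArrow (1 : Matrix (Fin n) (Fin n) ℝ≥0∞) = ident n :=
  Arrow.ext_mono fun e => by
    rw [substArrow_mono, linSubst_one, AlgHom.id_apply, ← mono_eq_coe]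
    rfl

theorem substArrow_mul {n m k : ℕ} (B : Matrix (Fin k) (Fin m) ℝ≥0∞)
    (A : Matrix (Fin m) (Fin n) ℝ≥0∞) :
    substArrow (B * A) = comp (substArrow B) (substArrow A) :=
  Arrow.ext_mono fun e => by
    rw [substArrow_mono, linSubst_mul, AlgHom.comp_apply, ← substArrow_coe, ← substArrow_mono]
    rfl

/-! ### Substitutions and tensor products -/

theorem tensorV_mono {n m : ℕ} (e : Fin (n + m) →₀ ℕ) :
    tensorV (mono (leftExp e)) (mono (rightExp e)) = mono e := by
  ext d
  change MvPowerSeries.coeff (leftExp d) (mono (leftExp e)) *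
    MvPowerSeries.coeff (rightExp d) (mono (rightExp e)) = _
  have h : d = e ↔ leftExp d = leftExp e ∧ rightExp d = rightExp e := by
    constructor
    · rintro rfl; simp
    · rintro ⟨h1, h2⟩
      ext i
      refine Fin.addCases (fun i => ?_) (fun i => ?_) i
      · simpa [leftExp] using DFunLike.congr_fun h1 i
      · simpa [rightExp] using DFunLike.congr_fun h2 i
  simp only [coeff_mono, h, ite_and]
  split_ifs <;> simp

/-- The exponent whose left and right parts are `a` and `b`. -/
def appendExp {n m : ℕ} (a : Fin n →₀ ℕ) (b : Fin m →₀ ℕ) : Fin (n + m) →₀ ℕ :=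
  Finsupp.equivFunOnFinite.symm (Fin.append a b)

theorem leftExp_appendExp {n m : ℕ} (a : Fin n →₀ ℕ) (b : Fin m →₀ ℕ) :
    leftExp (appendExp a b) = a := by
  ext i; simp [leftExp, appendExp]

theorem rightExp_appendExp {n m : ℕ} (a : Fin n →₀ ℕ) (b : Fin m →₀ ℕ) :
    rightExp (appendExp a b) = b := by
  ext i; simp [rightExp, appendExp]

theorem appendExp_eq {n m : ℕ} (e : Fin (n + m) →₀ ℕ) :
    appendExp (leftExp e) (rightExp e) = e := by
  ext i
  refine Fin.addCases (fun i => ?_) (fun i => ?_) i <;> simp [leftExp, rightExp, appendExp]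

theorem appendExp_mapDomain {n m : ℕ} (a : Fin n →₀ ℕ) (b : Fin m →₀ ℕ) :
    appendExp a b = a.mapDomain (Fin.castAdd m) + b.mapDomain (Fin.natAdd n) := by
  ext i
  refine Fin.addCases (fun i => ?_) (fun i => ?_) i
  · rw [Finsupp.add_apply, Finsupp.mapDomain_apply (Fin.castAdd_injective n m),
      Finsupp.mapDomain_of_notMem_range]
    · simp [appendExp]
    · rintro ⟨j, hj⟩
      have := congrArg Fin.val hj
      simp at this
      omega
  · rw [Finsupp.add_apply, Finsupp.mapDomain_apply (Fin.natAdd_injective m n),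
      Finsupp.mapDomain_of_notMem_range]
    · simp [appendExp]
    · rintro ⟨j, hj⟩
      have := congrArg Fin.val hj
      simp at this
      omega

theorem monomial_appendExp {n m : ℕ} (a : Fin n →₀ ℕ) (b : Fin m →₀ ℕ) :
    MvPolynomial.monomial (appendExp a b) (1 : ℝ≥0∞) =
      MvPolynomial.rename (Fin.castAdd m) (MvPolynomial.monomial a 1) *
        MvPolynomial.rename (Fin.natAdd n) (MvPolynomial.monomial b 1) := by
  rw [MvPolynomial.rename_monomial, MvPolynomial.rename_monomial, MvPolynomial.monomial_mul,
    appendExp_mapDomain, one_mul]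

theorem tensorV_add_left {n m : ℕ} (P P' : V n) (Q : V m) :
    tensorV (P + P') Q = tensorV P Q + tensorV P' Q := by
  funext e
  exact add_mul _ _ _

theorem tensorV_add_right {n m : ℕ} (P : V n) (Q Q' : V m) :
    tensorV P (Q + Q') = tensorV P Q + tensorV P Q' := by
  funext e
  exact mul_add _ _ _

theorem tensorV_smul_left {n m : ℕ} (c : ℝ≥0∞) (P : V n) (Q : V m) :
    tensorV (c • P) Q = c • tensorV P Q := by
  funext e
  exact mul_assoc _ _ _

theorem tensorV_smul_right {n m : ℕ} (c : ℝ≥0∞) (P : V n) (Q : V m) :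
    tensorV P (c • Q) = c • tensorV P Q := by
  funext e
  exact mul_left_comm _ _ _

/-- The tensor product is multiplication after making the variables disjoint. By bilinearity it
suffices to check monomials, where exponents are concatenated. -/
theorem tensorV_coe {n m : ℕ} (p : MvPolynomial (Fin n) ℝ≥0∞) (q : MvPolynomial (Fin m) ℝ≥0∞) :
    tensorV (p : V n) (q : V m) =
      ((MvPolynomial.rename (Fin.castAdd m) p * MvPolynomial.rename (Fin.natAdd n) q :
        MvPolynomial (Fin (n + m)) ℝ≥0∞) : V (n + m)) := by
  induction p using MvPolynomial.induction_on' with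
  | add p p' hp hp' =>
    rw [MvPolynomial.coe_add, tensorV_add_left, map_add, add_mul, MvPolynomial.coe_add, hp, hp']
  | monomial a c =>
    induction q using MvPolynomial.induction_on' with
    | add q q' hq hq' =>
      rw [MvPolynomial.coe_add, tensorV_add_right, map_add, mul_add, MvPolynomial.coe_add, hq, hq']
    | monomial b c' =>
      have h : ∀ {k : ℕ} (e : Fin k →₀ ℕ) (c : ℝ≥0∞), MvPolynomial.monomial e c =
          c • MvPolynomial.monomial e (1 : ℝ≥0∞) := by
        simp [MvPolynomial.smul_monomial]
      rw [h a c, h b c', map_smul, map_smul, smul_mul_assoc, mul_smul_comm,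
        ← monomial_appendExp, MvPolynomial.coe_smul, MvPolynomial.coe_smul, MvPolynomial.coe_smul,
        MvPolynomial.coe_smul, tensorV_smul_left, tensorV_smul_right, ← mono_eq_coe, ← mono_eq_coe,
        ← mono_eq_coe]
      congr 2
      rw [← tensorV_mono (appendExp a b), leftExp_appendExp, rightExp_appendExp]

/-- A block diagonal substitution never mixes the two groups of variables, so the image of a
monomial splits as a product. -/
theorem linSubst_blocks {n m n' m' : ℕ} (A : Matrix (Fin m) (Fin n) ℝ≥0∞)
    (B : Matrix (Fin m') (Fin n') ℝ≥0∞) (e : Fin (n + n') →₀ ℕ) :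
    linSubst (Matrix.reindex finSumFinEquiv finSumFinEquiv (Matrix.fromBlocks A 0 0 B))
        (MvPolynomial.monomial e 1) =
      MvPolynomial.rename (Fin.castAdd m') (linSubst A (MvPolynomial.monomial (leftExp e) 1)) *
        MvPolynomial.rename (Fin.natAdd m)
          (linSubst B (MvPolynomial.monomial (rightExp e) 1)) := by
  conv_lhs => rw [← appendExp_eq e, monomial_appendExp, map_mul]
  simp only [← AlgHom.comp_apply]
  congr 2
  · refine MvPolynomial.algHom_ext fun i => ?_
    simp [linSubst_X, Fin.sum_univ_add]
  · refine MvPolynomial.algHom_ext fun i => ?_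
    simp [linSubst_X, Fin.sum_univ_add]

theorem substArrow_blocks {n m n' m' : ℕ} (A : Matrix (Fin m) (Fin n) ℝ≥0∞)
    (B : Matrix (Fin m') (Fin n') ℝ≥0∞) :
    substArrow (Matrix.reindex finSumFinEquiv finSumFinEquiv (Matrix.fromBlocks A 0 0 B)) =
      tensor (substArrow A) (substArrow B) :=
  Arrow.ext_mono fun e => by
    rw [substArrow_mono, tensor, ofMono_mono, substArrow_mono, substArrow_mono, tensorV_coe,
      linSubst_blocks]

/-! ### The interpretation of matrices over `ℕ[t]` -/

/-- Evaluation of polynomials at `lam`. -/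
def evalAt (lam : ℝ≥0∞) : ℕ[X] →+* ℝ≥0∞ := Polynomial.eval₂RingHom (Nat.castRingHom ℝ≥0∞) lam

theorem evalAt_X (lam : ℝ≥0∞) : evalAt lam Polynomial.X = lam := by simp [evalAt]

theorem map_directSum {n m n' m' : ℕ} (φ : ℕ[X] →+* ℝ≥0∞) (A : Matrix (Fin m) (Fin n) ℕ[X])
    (B : Matrix (Fin m') (Fin n') ℕ[X]) :
    (directSum A B).map φ = Matrix.reindex finSumFinEquiv finSumFinEquiv
      (Matrix.fromBlocks (A.map φ) 0 0 (B.map φ)) := by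
  rw [directSum, Matrix.reindex_apply, Matrix.reindex_apply, ← Matrix.submatrix_map,
    Matrix.fromBlocks_map]
  simp

theorem coe_pow_monomial (k : ℕ) :
    pow k = ((MvPolynomial.X 0 ^ k : MvPolynomial (Fin 1) ℝ≥0∞) : V 1) := by
  rw [pow, mono_eq_coe, MvPolynomial.X_pow_eq_monomial]

/-- The interpretation of matrices over `ℕ[t]` by linear substitutions. -/
def substFunctor (lam : ℝ≥0∞) : PropFunctor where
  map A := substArrow (A.map (evalAt lam))
  map_comp B A := by rw [Matrix.map_mul, substArrow_mul]
  map_tensor A B := by rw [map_directSum, substArrow_blocks]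
  map_empty := by rw [Matrix.map_one _ (map_zero _) (map_one _), substArrow_one]
  map_ident := by rw [Matrix.map_one _ (map_zero _) (map_one _), substArrow_one]
  map_symm := Arrow.ext_mono fun e => by
    rw [substArrow_mono, linSubst_monomial, symmetry, ofMono_mono, mono_eq_coe]
    congr 1
    rw [MvPolynomial.monomial_eq, Finsupp.prod_fintype _ _ (by simp)]
    simp [Fin.prod_univ_two, Fin.sum_univ_two, mul_comm]

theorem substFunctor_isBinomial (lam : ℝ≥0∞) : (substFunctor lam).IsBinomial lam where
  map_mul := Arrow.ext_mono fun e => by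
    change (substArrow _).toLin _ = _
    rw [substArrow_mono, linSubst_monomial, mul, ofMono_mono, coe_pow_monomial]
    simp [Fin.prod_univ_two, pow_add]
  map_unit := Arrow.ext_mono fun e => by
    change (substArrow _).toLin _ = _
    rw [substArrow_mono, linSubst_monomial, unit, ofMono_mono, coe_pow_monomial]
    simp
  map_comul := Arrow.ext_mono fun e => by
    change (substArrow _).toLin _ = _
    rw [substArrow_mono, linSubst_monomial, comul, ofMono_mono]
    simp only [coe_pow_monomial, tensorV_coe]
    rw [Fin.prod_univ_one, Fin.sum_univ_two]
    simp only [Matrix.map_apply]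
    -- The substitution is `X ↦ X + Y`; the binomial theorem produces the coefficients of `comul`.
    simp [add_pow]
    rw [← MvPolynomial.coeToMvPowerSeries.ringHom_apply, map_sum]
    refine Finset.sum_congr rfl fun j _ => ?_
    rw [map_mul, map_mul, map_natCast, Nat.cast_smul_eq_nsmul, nsmul_eq_mul, mul_comm]
    simp
  map_counit := Arrow.ext_mono fun e => by
    change (substArrow _).toLin _ = _
    rw [substArrow_mono, linSubst_monomial, counit, ofMono_mono]
    simp only [Fin.prod_univ_one, Finset.univ_eq_empty, Finset.sum_empty]
    split_ifs with h <;> simp [h]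
  map_scale := Arrow.ext_mono fun e => by
    change (substArrow _).toLin _ = _
    rw [substArrow_mono, linSubst_monomial, scale, ofMono_mono, coe_pow_monomial,
      ← MvPolynomial.coe_smul]
    simp [evalAt_X, mul_pow, MvPolynomial.smul_eq_C_mul]

/-! ### Traces of linear substitutions -/

/-- Exponents in `n + 1` variables are pairs of a first exponent and the remaining ones. -/
def consExpEquiv (n : ℕ) : ℕ × (Fin n →₀ ℕ) ≃ (Fin (n + 1) →₀ ℕ) where
  toFun p := Finsupp.cons p.1 p.2
  invFun e := (e 0, e.tail)
  left_inv p := by simp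
  right_inv e := Finsupp.cons_tail e

theorem tsum_cons (n : ℕ) (f : (Fin (n + 1) →₀ ℕ) → ℝ≥0∞) :
    ∑' e, f e = ∑' e : Fin n →₀ ℕ, ∑' k : ℕ, f (Finsupp.cons k e) := by
  rw [← (consExpEquiv n).tsum_eq, ENNReal.tsum_prod', ENNReal.tsum_comm]
  rfl

theorem coeff_trace {n m : ℕ} (f : Arrow (n + 1) (m + 1)) (d : Fin m →₀ ℕ) (e : Fin n →₀ ℕ) :
    MvPowerSeries.coeff d ((trace f).toLin (mono e)) =
      ∑' k : ℕ, MvPowerSeries.coeff (Finsupp.cons k d) (f.toLin (mono (Finsupp.cons k e))) := by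
  rw [trace, ofMono_mono]
  rfl

/-- The full trace is the sum of the diagonal coefficients. -/
theorem scalar_traceAll (n : ℕ) (f : Arrow n n) :
    scalar (traceAll n f) = ∑' e, MvPowerSeries.coeff e (f.toLin (mono e)) := by
  induction n with
  | zero =>
    rw [tsum_eq_single 0 fun e he => (he (Subsingleton.elim _ _)).elim]
    rfl
  | succ n ih =>
    rw [traceAll, ih, tsum_cons]
    simp only [coeff_trace]

/-- In `[0, ∞]` sums can be rearranged freely, so the Cauchy product needs no convergence
hypothesis. -/
theorem tsum_mul_tsum_antidiagonal (f g : ℕ → ℝ≥0∞) :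
    (∑' i, f i) * ∑' j, g j = ∑' n, ∑ p ∈ Finset.HasAntidiagonal.antidiagonal n, f p.1 * g p.2 := by
  have h : (∑' i, f i) * ∑' j, g j = ∑' p : ℕ × ℕ, f p.1 * g p.2 := by
    rw [ENNReal.tsum_prod', ← ENNReal.tsum_mul_right]
    simp only [ENNReal.tsum_mul_left]
  rw [h, ← Finset.HasAntidiagonal.sigmaAntidiagonalEquivProd.tsum_eq, ENNReal.tsum_sigma']
  refine tsum_congr fun n => ?_
  rw [tsum_fintype]
  exact Finset.sum_finset_coe (fun p : ℕ × ℕ => f p.1 * g p.2) _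

/-- The geometric series. -/
def star (a : ℝ≥0∞) : ℝ≥0∞ := ∑' k : ℕ, a ^ k

/-- The negative binomial series, valid in `[0, ∞]` even for `a ≥ 1`. The induction is a Cauchy
product followed by the hockey-stick identity. -/
theorem star_pow_succ (a : ℝ≥0∞) (j : ℕ) :
    star a ^ (j + 1) = ∑' i : ℕ, ((i + j).choose j : ℝ≥0∞) * a ^ i := by
  induction j with
  | zero => simp [star]
  | succ j ih =>
    rw [pow_succ, ih, star, tsum_mul_tsum_antidiagonal]
    refine tsum_congr fun n => ?_
    rw [Finset.Nat.sum_antidiagonal_eq_sum_range_succ_mk]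
    have h : ∀ i ∈ Finset.range n.succ, ((i + j).choose j : ℝ≥0∞) * a ^ i * a ^ (n - i) =
        ((i + j).choose j : ℝ≥0∞) * a ^ n := by
      intro i hi
      rw [mul_assoc, ← pow_add, Nat.add_sub_cancel' (Nat.lt_succ_iff.mp (Finset.mem_range.mp hi))]
    rw [Finset.sum_congr rfl h, ← Finset.sum_mul, ← Nat.cast_sum, Nat.sum_range_add_choose]
    rfl

theorem coeff_linear_pow {R : Type*} [CommSemiring R] (a l : R) (i j : ℕ) :
    ((Polynomial.C a * Polynomial.X + Polynomial.C l) ^ (i + j)).coeff i =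
      (i + j).choose j * a ^ i * l ^ j := by
  rw [add_pow, Polynomial.finsetSum_coeff, Finset.sum_eq_single i]
  · rw [mul_pow, ← Polynomial.C_pow, ← Polynomial.C_pow, Nat.add_sub_cancel_left,
      ← Polynomial.C_eq_natCast, mul_assoc, ← Polynomial.C_mul, Polynomial.coeff_mul_C,
      Polynomial.coeff_C_mul_X_pow, if_pos rfl, Nat.choose_symm_add]
    ring
  · intro b _ hb
    rw [mul_pow, ← Polynomial.C_pow, ← Polynomial.C_pow, ← Polynomial.C_eq_natCast, mul_assoc,
      ← Polynomial.C_mul, Polynomial.coeff_mul_C, Polynomial.coeff_C_mul_X_pow, if_neg hb.symm,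
      zero_mul]
  · simp

/-- Summing the coefficients of `Y ^ k` in `(a Y + l) ^ k * G(Y)` substitutes `l / (1 - a)` for `Y`
in `G(Y) / (1 - a)`. -/
theorem tsum_coeff_linear_pow_mul {n : ℕ} (a : ℝ≥0∞) (l : MvPolynomial (Fin n) ℝ≥0∞)
    (G : Polynomial (MvPolynomial (Fin n) ℝ≥0∞)) (d : Fin n →₀ ℕ) :
    ∑' k : ℕ, MvPolynomial.coeff d
        (((Polynomial.C (MvPolynomial.C a) * Polynomial.X + Polynomial.C l) ^ k * G).coeff k) =
      star a * MvPolynomial.coeff d (G.eval (MvPolynomial.C (star a) * l)) := by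
  -- Both sides are additive in `G`, so `G = g * Y ^ j` suffices.
  induction G using Polynomial.induction_on' with
  | add p q hp hq =>
    simp only [mul_add, Polynomial.coeff_add, MvPolynomial.coeff_add, Polynomial.eval_add,
      ENNReal.tsum_add, hp, hq]
  | monomial j g =>
    -- Terms with `k < j` vanish because of the factor `Y ^ j`. The remaining indices are written `k
    -- = i + j`, which leaves the coefficient of `Y ^ i` in `(a Y + l) ^ (i + j)`.
    have h0 : ∀ k ∈ Finset.range j, MvPolynomial.coeff d
        (((Polynomial.C (MvPolynomial.C a) * Polynomial.X + Polynomial.C l) ^ k *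
          Polynomial.monomial j g).coeff k) = 0 := by
      intro k hk
      rw [← Polynomial.C_mul_X_pow_eq_monomial, ← mul_assoc, Polynomial.coeff_mul_X_pow',
        if_neg (by simpa using hk), MvPolynomial.coeff_zero]
    have h : ∀ i : ℕ, MvPolynomial.coeff d
        (((Polynomial.C (MvPolynomial.C a) * Polynomial.X + Polynomial.C l) ^ (i + j) *
          Polynomial.monomial j g).coeff (i + j)) =
        ((i + j).choose j : ℝ≥0∞) * a ^ i * MvPolynomial.coeff d (g * l ^ j) := by
      intro i
      rw [Polynomial.coeff_mul_monomial, coeff_linear_pow, ← MvPolynomial.C_pow,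
        ← map_natCast (MvPolynomial.C (σ := Fin n) (R := ℝ≥0∞)), ← MvPolynomial.C_mul,
        mul_assoc, mul_comm (l ^ j),
        MvPolynomial.coeff_C_mul]
    rw [← Summable.sum_add_tsum_nat_add' (k := j) ENNReal.summable, Finset.sum_eq_zero h0, zero_add,
      tsum_congr h, ENNReal.tsum_mul_right, ← star_pow_succ, Polynomial.eval_monomial, mul_pow,
      ← MvPolynomial.C_pow, mul_left_comm, MvPolynomial.coeff_C_mul, pow_succ', mul_assoc]

/-- The matrix of the trace of a linear substitution. -/
def schur {n m : ℕ} (B : Matrix (Fin (m + 1)) (Fin (n + 1)) ℝ≥0∞) :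
    Matrix (Fin m) (Fin n) ℝ≥0∞ :=
  Matrix.of fun j i => B j.succ i.succ + B j.succ 0 * star (B 0 0) * B 0 i.succ

/-- View everything as polynomials in the first variable `Y` over the others. The image of `Y` is `a
Y + l`, and feeding it back solves `Y = a Y + l`, that is, `Y = star a * l`. Putting this into the
images of the other variables gives the entries of `schur B`. -/
theorem tsum_coeff_linSubst_cons {n m : ℕ} (B : Matrix (Fin (m + 1)) (Fin (n + 1)) ℝ≥0∞)
    (d : Fin m →₀ ℕ) (e : Fin n →₀ ℕ) :
    ∑' k : ℕ, MvPolynomial.coeff (Finsupp.cons k d)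
        (linSubst B (MvPolynomial.monomial (Finsupp.cons k e) 1)) =
      star (B 0 0) *
        MvPolynomial.coeff d (linSubst (schur B) (MvPolynomial.monomial e 1)) := by
  have hX : ∀ i, MvPolynomial.finSuccEquiv ℝ≥0∞ m
      (∑ j, MvPolynomial.C (B j i) * MvPolynomial.X j) =
      Polynomial.C (MvPolynomial.C (B 0 i)) * Polynomial.X +
        Polynomial.C (∑ j : Fin m, MvPolynomial.C (B j.succ i) * MvPolynomial.X j) := by
    intro i
    have hC : ∀ r : ℝ≥0∞, MvPolynomial.finSuccEquiv ℝ≥0∞ m (MvPolynomial.C r) =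
        Polynomial.C (MvPolynomial.C r) := (MvPolynomial.finSuccEquiv ℝ≥0∞ m).commutes
    simp [Fin.sum_univ_succ, MvPolynomial.finSuccEquiv_X_zero, MvPolynomial.finSuccEquiv_X_succ, hC]
  have h : ∀ k : ℕ, MvPolynomial.coeff (Finsupp.cons k d)
      (linSubst B (MvPolynomial.monomial (Finsupp.cons k e) 1)) =
      MvPolynomial.coeff d (((Polynomial.C (MvPolynomial.C (B 0 0)) * Polynomial.X +
        Polynomial.C (∑ j : Fin m, MvPolynomial.C (B j.succ 0) * MvPolynomial.X j)) ^ k *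
        ∏ i : Fin n, (Polynomial.C (MvPolynomial.C (B 0 i.succ)) * Polynomial.X +
          Polynomial.C (∑ j : Fin m, MvPolynomial.C (B j.succ i.succ) *
            MvPolynomial.X j)) ^ e i).coeff k) := by
    intro k
    rw [← MvPolynomial.finSuccEquiv_coeff_coeff, linSubst_monomial, map_prod, Fin.prod_univ_succ]
    simp only [map_pow, hX, Finsupp.cons_zero, Finsupp.cons_succ]
  simp only [h]
  rw [tsum_coeff_linear_pow_mul, linSubst_monomial, Polynomial.eval_prod]
  congr 2
  refine Finset.prod_congr rfl fun i _ => ?_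
  simp only [Polynomial.eval_pow, Polynomial.eval_add, Polynomial.eval_mul, Polynomial.eval_C,
    Polynomial.eval_X, schur, Matrix.of_apply, map_add, map_mul, add_mul, Finset.sum_add_distrib,
    Finset.mul_sum]
  rw [add_comm]
  congr 2
  refine Finset.sum_congr rfl fun j _ => ?_
  ring

/-- The sum of the diagonal coefficients of a linear substitution. -/
def diagSum {n : ℕ} (B : Matrix (Fin n) (Fin n) ℝ≥0∞) : ℝ≥0∞ :=
  ∑' e, MvPolynomial.coeff e (linSubst B (MvPolynomial.monomial e 1))

theorem diagSum_zero (B : Matrix (Fin 0) (Fin 0) ℝ≥0∞) : diagSum B = 1 := by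
  rw [diagSum, tsum_eq_single 0 fun e he => (he (Subsingleton.elim _ _)).elim, linSubst_monomial]
  simp

/-- This recursion is the one satisfied by `1 / det (1 - B)` under elimination of the first
variable. -/
theorem diagSum_succ {n : ℕ} (B : Matrix (Fin (n + 1)) (Fin (n + 1)) ℝ≥0∞) :
    diagSum B = star (B 0 0) * diagSum (schur B) := by
  rw [diagSum, tsum_cons]
  simp only [tsum_coeff_linSubst_cons]
  rw [ENNReal.tsum_mul_left]
  rfl

theorem scalar_traceAll_substArrow {n : ℕ} (B : Matrix (Fin n) (Fin n) ℝ≥0∞) :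
    scalar (traceAll n (substArrow B)) = diagSum B := by
  rw [scalar_traceAll, diagSum]
  simp only [substArrow_mono, MvPolynomial.coeff_coe]

/-! ### Power series with natural coefficients -/

/-- Evaluation at `lam ∈ [0, ∞]` of power series with natural coefficients. -/
def evalSeries (lam : ℝ≥0∞) : PowerSeries ℕ →+* ℝ≥0∞ where
  toFun P := ∑' k, ((PowerSeries.coeff k P : ℕ) : ℝ≥0∞) * lam ^ k
  map_zero' := by simp
  map_one' := by
    rw [tsum_eq_single 0]
    · simp
    · intro k hk
      simp [PowerSeries.coeff_one, hk]
  map_add' P Q := by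
    simp only [map_add, Nat.cast_add, add_mul]
    exact ENNReal.tsum_add
  map_mul' P Q := by
    rw [tsum_mul_tsum_antidiagonal]
    refine tsum_congr fun n => ?_
    rw [PowerSeries.coeff_mul, Nat.cast_sum, Finset.sum_mul]
    refine Finset.sum_congr rfl fun p hp => ?_
    rw [← Finset.HasAntidiagonal.mem_antidiagonal.mp hp, pow_add, Nat.cast_mul]
    ring

theorem evalSeries_apply (lam : ℝ≥0∞) (P : PowerSeries ℕ) :
    evalSeries lam P = ∑' k, ((PowerSeries.coeff k P : ℕ) : ℝ≥0∞) * lam ^ k := rfl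

theorem evalSeries_X (lam : ℝ≥0∞) : evalSeries lam PowerSeries.X = lam := by
  rw [evalSeries_apply, tsum_eq_single 1]
  · simp
  · intro k hk
    simp [PowerSeries.coeff_X, hk]

theorem coeff_pow_eq_zero {R : Type*} [CommSemiring R] {b : PowerSeries R}
    (hb : PowerSeries.constantCoeff b = 0) {n k : ℕ} (h : n < k) :
    PowerSeries.coeff n (b ^ k) = 0 := by
  have : PowerSeries.X ^ k ∣ b ^ k := pow_dvd_pow_of_dvd (PowerSeries.X_dvd_iff.mpr hb) k
  exact PowerSeries.X_pow_dvd_iff.mp this n h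

/-- The geometric series `1 + b + b ^ 2 + ⋯` of a power series without constant term. -/
def geomSeries (b : PowerSeries ℕ) : PowerSeries ℕ :=
  PowerSeries.mk fun n => ∑ k ∈ Finset.range (n + 1), PowerSeries.coeff n (b ^ k)

theorem coeff_geomSeries {b : PowerSeries ℕ} (hb : PowerSeries.constantCoeff b = 0) {n N : ℕ}
    (h : n < N) :
    PowerSeries.coeff n (geomSeries b) = ∑ k ∈ Finset.range N, PowerSeries.coeff n (b ^ k) := by
  rw [geomSeries, PowerSeries.coeff_mk]
  refine Finset.sum_subset (Finset.range_mono h) fun k _ hk => coeff_pow_eq_zero hb ?_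
  simpa using hk

/-- The subtraction-free form of `(1 - b) * geomSeries b = 1`, as required over `ℕ`. -/
theorem geomSeries_eq {b : PowerSeries ℕ} (hb : PowerSeries.constantCoeff b = 0) :
    geomSeries b = 1 + b * geomSeries b := by
  ext n
  -- Up to degree `n` the geometric series agrees with its partial sum over `k ≤ n`, since `b ^ k`
  -- has order at least `k`.
  have h : PowerSeries.coeff n (b * geomSeries b) =
      PowerSeries.coeff n (b * ∑ k ∈ Finset.range (n + 1), b ^ k) := by
    rw [PowerSeries.coeff_mul, PowerSeries.coeff_mul]
    refine Finset.sum_congr rfl fun p hp => ?_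
    rw [coeff_geomSeries hb (N := n + 1), map_sum]
    have := Finset.HasAntidiagonal.mem_antidiagonal.mp hp
    omega
  rw [map_add, h, coeff_geomSeries hb (N := n + 1 + 1) (by omega), Finset.sum_range_succ',
    Finset.mul_sum, map_sum, pow_zero, add_comm]
  simp only [pow_succ']

/-- Exchange the sums over powers of `b` and over degrees; in degree `n` only the powers `k ≤ n`
contribute. -/
theorem evalSeries_geomSeries (lam : ℝ≥0∞) {b : PowerSeries ℕ}
    (hb : PowerSeries.constantCoeff b = 0) :
    evalSeries lam (geomSeries b) = star (evalSeries lam b) := by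
  rw [star]
  simp only [← map_pow]
  simp only [evalSeries_apply]
  rw [ENNReal.tsum_comm]
  refine tsum_congr fun n => ?_
  rw [ENNReal.tsum_mul_right, tsum_eq_sum (s := Finset.range (n + 1)), geomSeries,
    PowerSeries.coeff_mk, Nat.cast_sum]
  intro k hk
  rw [coeff_pow_eq_zero hb (by simpa using hk), Nat.cast_zero]

/-! ### The MacMahon master theorem -/

/-- Elimination of the first variable in `det (1 - B)`. -/
theorem det_one_sub_succ {R : Type*} [CommRing R] {n : ℕ}
    (B : Matrix (Fin (n + 1)) (Fin (n + 1)) R) (s : R) (hs : s * (1 - B 0 0) = 1) :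
    (1 - B).det = (1 - B 0 0) *
      (1 - Matrix.of fun j i : Fin n => B j.succ i.succ + B j.succ 0 * s * B 0 i.succ).det := by
  -- Add `B j.succ 0 * s` times the first row to row `j.succ`. Since `s` inverts the pivot `1 - B 0
  -- 0`, this clears the first column below it.
  let N : Matrix (Fin (n + 1)) (Fin (n + 1)) R := Matrix.of fun j i =>
    (1 - B) j i + (Fin.cases 0 (fun j => B j.succ 0 * s) j : R) * (1 - B) 0 i
  have hN : N.det = (1 - B).det :=
    Matrix.det_eq_of_forall_row_eq_smul_add_const _ 0 rfl fun j i => rfl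
  rw [← hN, Matrix.det_succ_column_zero, Fin.sum_univ_succ, Finset.sum_eq_zero, add_zero]
  · have h0 : N 0 0 = 1 - B 0 0 := by simp [N]
    rw [h0, Fin.val_zero, pow_zero, one_mul]
    congr 2
    ext j i
    have h1 : (1 : Matrix (Fin (n + 1)) (Fin (n + 1)) R) j.succ i.succ =
        (1 : Matrix (Fin n) (Fin n) R) j i := by simp [Matrix.one_apply]
    have h2 : (1 : Matrix (Fin (n + 1)) (Fin (n + 1)) R) 0 i.succ = 0 :=
      Matrix.one_apply_ne (Fin.succ_ne_zero i).symm
    simp only [N, Matrix.submatrix_apply, Fin.succAbove_zero, Matrix.of_apply, Fin.cases_succ,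
      Matrix.sub_apply, h1, h2]
    ring
  · intro j _
    have h : N j.succ 0 = 0 := by
      have h1 : (1 : Matrix (Fin (n + 1)) (Fin (n + 1)) R) j.succ 0 = 0 :=
        Matrix.one_apply_ne (Fin.succ_ne_zero j)
      simp only [N, Matrix.of_apply, Fin.cases_succ, Matrix.sub_apply, h1, Matrix.one_apply_eq]
      rw [mul_assoc, hs]
      ring
    rw [h, mul_zero, zero_mul]

/-- The MacMahon master theorem: the diagonal sum is the evaluation of the inverse of
`det (1 - B)`. -/
theorem exists_inverse_det_eq_diagSum {n : ℕ} (B : Matrix (Fin n) (Fin n) (PowerSeries ℕ))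
    (hB : ∀ i j, PowerSeries.constantCoeff (B i j) = 0) :
    ∃ Z : PowerSeries ℕ,
      PowerSeries.map (Nat.castRingHom ℚ) Z *
        (1 - B.map (PowerSeries.map (Nat.castRingHom ℚ))).det = 1 ∧
      ∀ lam, diagSum (B.map (evalSeries lam)) = evalSeries lam Z := by
  induction n with
  | zero => exact ⟨1, by simp, fun lam => by rw [diagSum_zero, map_one]⟩
  | succ n ih =>
    have h0 := hB 0 0
    -- The Schur complement over `ℕ⟦t⟧`, with `geomSeries` in the role of `1 / (1 - B 0 0)`; its
    -- entries again have zero constant term. It specializes to `schur` in `[0, ∞]` and to the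
    -- complement of `det_one_sub_succ` over `ℚ⟦t⟧`.
    obtain ⟨Z, hZ, hZ'⟩ := ih (Matrix.of fun j i : Fin n =>
      B j.succ i.succ + B j.succ 0 * geomSeries (B 0 0) * B 0 i.succ) (by simp [hB])
    refine ⟨geomSeries (B 0 0) * Z, ?_, fun lam => ?_⟩
    · have hs : PowerSeries.map (Nat.castRingHom ℚ) (geomSeries (B 0 0)) *
          (1 - B.map (PowerSeries.map (Nat.castRingHom ℚ)) 0 0) = 1 := by
        have h := congrArg (PowerSeries.map (Nat.castRingHom ℚ)) (geomSeries_eq h0)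
        rw [map_add, map_mul, map_one] at h
        rw [Matrix.map_apply]
        linear_combination h
      have hM : (Matrix.of fun j i : Fin n =>
          B j.succ i.succ + B j.succ 0 * geomSeries (B 0 0) * B 0 i.succ).map
            (PowerSeries.map (Nat.castRingHom ℚ)) =
          Matrix.of fun j i : Fin n => B.map (PowerSeries.map (Nat.castRingHom ℚ)) j.succ i.succ +
            B.map (PowerSeries.map (Nat.castRingHom ℚ)) j.succ 0 *
            PowerSeries.map (Nat.castRingHom ℚ) (geomSeries (B 0 0)) *
            B.map (PowerSeries.map (Nat.castRingHom ℚ)) 0 i.succ := by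
        ext1 j i
        simp only [Matrix.map_apply, Matrix.of_apply, map_add, map_mul]
      rw [hM] at hZ
      rw [det_one_sub_succ _ _ hs, map_mul, mul_mul_mul_comm, hs, hZ, one_mul]
    · rw [diagSum_succ, map_mul, evalSeries_geomSeries lam h0, ← hZ', Matrix.map_apply]
      congr 2
      ext1 j i
      simp only [schur, Matrix.map_apply, Matrix.of_apply, map_add, map_mul,
        evalSeries_geomSeries lam h0]

/-- The interpretation of a matrix is the value of the power series `1 / det (1 - t M)`, which has
natural coefficients. -/
theorem exists_inverse_det_eq_trace {n : ℕ} (M : Matrix (Fin n) (Fin n) ℕ) :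
    ∃ Z : PowerSeries ℕ,
      PowerSeries.map (Nat.castRingHom ℚ) Z *
        (1 - (PowerSeries.X : PowerSeries ℚ) • M.map (fun a => (a : PowerSeries ℚ))).det = 1 ∧
      ∀ lam, (substFunctor lam).interpret M = evalSeries lam Z := by
  obtain ⟨Z, hZ, hZ'⟩ := exists_inverse_det_eq_diagSum
    (Matrix.of fun i j => (PowerSeries.X : PowerSeries ℕ) * (M i j : PowerSeries ℕ)) (by simp)
  refine ⟨Z, ?_, fun lam => ?_⟩
  · convert hZ using 3
    congr 1
    ext1 i j
    simp
  · rw [← hZ' lam, PropFunctor.interpret]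
    change scalar (traceAll n (substArrow _)) = _
    rw [scalar_traceAll_substArrow]
    congr 1
    ext1 i j
    simp [tMatrix, evalAt_X, evalSeries_X]

/-! ### Jacobi's formula -/

theorem derivation_prod {A R ι : Type*} [CommSemiring A] [CommRing R] [Algebra A R] [DecidableEq ι]
    (D : Derivation A R R) (s : Finset ι) (f : ι → R) :
    D (∏ i ∈ s, f i) = ∑ i ∈ s, (∏ j ∈ s.erase i, f j) * D (f i) := by
  induction s using Finset.induction_on with
  | empty => simp
  | insert a s ha ih =>
    rw [Finset.prod_insert ha, D.leibniz, ih, Finset.sum_insert ha, Finset.erase_insert ha,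
      smul_eq_mul, smul_eq_mul, Finset.mul_sum, add_comm]
    congr 1
    refine Finset.sum_congr rfl fun i hi => ?_
    rw [Finset.erase_insert_of_ne (fun h : a = i => ha (h ▸ hi)), Finset.prod_insert (by simp [ha]),
      mul_assoc]

/-- By the Leibniz rule the derivative is the sum over columns of the determinant with that column
differentiated; Cramer's rule identifies this sum with the trace. -/
theorem derivation_det {A R ι : Type*} [CommSemiring A] [CommRing R] [Algebra A R] [Fintype ι]
    [DecidableEq ι] (D : Derivation A R R) (N : Matrix ι ι R) :
    D N.det = (N.adjugate * N.map D).trace := by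
  have h : ∀ i, (N.updateCol i fun k => D (N k i)).det =
      ∑ σ : Equiv.Perm ι, Equiv.Perm.sign σ •
        ((∏ j ∈ Finset.univ.erase i, N (σ j) j) * D (N (σ i) i)) := by
    intro i
    rw [Matrix.det_apply]
    refine Finset.sum_congr rfl fun σ _ => ?_
    rw [← Finset.mul_prod_erase _ _ (Finset.mem_univ i), Matrix.updateCol_self, mul_comm]
    congr 2
    refine Finset.prod_congr rfl fun j hj => ?_
    rw [Matrix.updateCol_ne (Finset.ne_of_mem_erase hj)]
  have h' : (N.adjugate * N.map D).trace = ∑ i, (N.updateCol i fun k => D (N k i)).det := by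
    refine Finset.sum_congr rfl fun i _ => ?_
    rw [← Matrix.cramer_apply, Matrix.cramer_eq_adjugate_mulVec]
    rfl
  rw [h', Matrix.det_apply, map_sum]
  simp only [h]
  rw [Finset.sum_comm]
  refine Finset.sum_congr rfl fun σ _ => ?_
  rw [← Finset.smul_sum, ← derivation_prod, Units.smul_def, Units.smul_def, map_zsmul]

/-- The logarithmic derivative of `det (1 - t M)` is `-∑ₖ tr (M ^ (k + 1)) t ^ k`. -/
theorem derivative_det_one_sub {R ι : Type*} [CommRing R] [Fintype ι] [DecidableEq ι]
    (M : Matrix ι ι R) :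
    PowerSeries.derivative R
        (1 - (PowerSeries.X : PowerSeries R) • M.map (PowerSeries.C (R := R))).det =
      -(1 - (PowerSeries.X : PowerSeries R) • M.map (PowerSeries.C (R := R))).det *
        PowerSeries.mk fun k => (M ^ (k + 1)).trace := by
  set N := 1 - (PowerSeries.X : PowerSeries R) • M.map (PowerSeries.C (R := R)) with hN
  -- `G = ∑ M ^ k t ^ k` is the Neumann series inverting `1 - t M`, so the adjugate is `det N • G`.
  let G : Matrix ι ι (PowerSeries R) := Matrix.of fun i j => PowerSeries.mk fun k => (M ^ k) i j
  have hNG : N * G = 1 := by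
    rw [hN, sub_mul, one_mul, smul_mul_assoc, sub_eq_iff_eq_add]
    ext i j k
    cases k with
    | zero =>
      have h1 : PowerSeries.coeff 0 ((1 : Matrix ι ι (PowerSeries R)) i j) =
          (1 : Matrix ι ι R) i j := by
        rw [Matrix.one_apply, Matrix.one_apply]
        split_ifs <;> simp
      rw [Matrix.add_apply, map_add, h1]
      simp [G]
    | succ k =>
      have h1 : PowerSeries.coeff (k + 1) ((1 : Matrix ι ι (PowerSeries R)) i j) = 0 := by
        rw [Matrix.one_apply]
        split_ifs <;> simp [PowerSeries.coeff_one]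
      simp [G, PowerSeries.coeff_succ_X_mul, Matrix.mul_apply, pow_succ', h1]
  have hadj : N.adjugate = N.det • G := by
    rw [← mul_one N.adjugate, ← hNG, ← mul_assoc, Matrix.adjugate_mul, smul_mul_assoc, one_mul]
  have hD : N.map (PowerSeries.derivative R) = -M.map (PowerSeries.C (R := R)) := by
    ext1 i j
    have h1 : PowerSeries.derivative R ((1 : Matrix ι ι (PowerSeries R)) i j) = 0 := by
      rw [Matrix.one_apply]
      split_ifs <;> simp
    rw [Matrix.map_apply, hN, Matrix.sub_apply, map_sub, h1]
    simp
  rw [derivation_det, hadj, hD, mul_neg, Matrix.trace_neg, smul_mul_assoc, Matrix.trace_smul,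
    smul_eq_mul, neg_mul]
  congr 2
  ext k
  simp [Matrix.trace, Matrix.mul_apply, G, pow_succ]

/-! ### Periodic points of the edge shift -/

/-- Here `v` lists the interior vertices of a walk from `a` to `b`; `cons a v` lists the sources of
its steps and `snoc v b` their targets. -/
theorem pow_succ_apply_eq_sum {R ι : Type*} [CommSemiring R] [Fintype ι] [DecidableEq ι]
    (M : Matrix ι ι R) (k : ℕ) (a b : ι) :
    (M ^ (k + 1)) a b = ∑ v : Fin k → ι, ∏ i : Fin (k + 1),
      M (Fin.cons (α := fun _ => ι) a v i) (Fin.snoc (α := fun _ => ι) v b i) := by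
  induction k generalizing a with
  | zero =>
    rw [Fintype.sum_unique]
    change (M ^ 1) a b = ∏ i : Fin 1, M (Fin.cons (α := fun _ => ι) a default i)
      (Fin.snoc (α := fun _ => ι) default b i)
    rw [Fin.prod_univ_one, pow_one]
    rfl
  | succ k ih =>
    rw [pow_succ', Matrix.mul_apply, ← (Fin.consEquiv fun _ => ι).sum_comp, Fintype.sum_prod_type]
    refine Finset.sum_congr rfl fun c _ => ?_
    rw [ih, Finset.mul_sum]
    refine Finset.sum_congr rfl fun v _ => ?_
    rw [Fin.prod_univ_succ (n := k + 1)]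
    change _ = M (Fin.cons (α := fun _ => ι) a (Fin.cons (α := fun _ => ι) c v) 0)
      (Fin.snoc (α := fun _ => ι) (Fin.cons (α := fun _ => ι) c v) b 0) * ∏ i : Fin (k + 1),
      M (Fin.cons (α := fun _ => ι) a (Fin.cons (α := fun _ => ι) c v) i.succ)
      (Fin.snoc (α := fun _ => ι) (Fin.cons (α := fun _ => ι) c v) b i.succ)
    rw [← Fin.cons_snoc_eq_snoc_cons]
    rfl

/-- The trace of a power is a sum over closed walks. -/
theorem trace_pow_succ_eq_sum {R ι : Type*} [CommSemiring R] [Fintype ι] [DecidableEq ι]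
    (M : Matrix ι ι R) (k : ℕ) :
    (M ^ (k + 1)).trace = ∑ v : Fin (k + 1) → ι, ∏ i, M (v i) (v (i + 1)) := by
  rw [← (Fin.consEquiv fun _ => ι).sum_comp, Fintype.sum_prod_type]
  refine Finset.sum_congr rfl fun a _ => ?_
  rw [Matrix.diag_apply, pow_succ_apply_eq_sum]
  refine Finset.sum_congr rfl fun v _ => Finset.prod_congr rfl fun i _ => ?_
  -- For a closed walk the targets are the sources rotated by one, with addition in `Fin (k + 1)`
  -- wrapping around.
  rw [Fin.snoc_eq_cons_rotate]
  simp only [finRotate_apply]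
  rfl

theorem iterate_shiftMap {α : Type} (m : ℕ) (x : ℤ → α) :
    shiftMap^[m] x = fun i => x (i + m) := by
  induction m generalizing x with
  | zero => simp
  | succ m ih =>
    rw [Function.iterate_succ_apply, ih]
    funext i
    simp [shiftMap, add_assoc]

/-- Periodic biinfinite walks are cyclic walks. -/
theorem card_periodic {α : Type} (r : α → α → Prop) (k : ℕ) :
    Set.ncard {x : ℤ → α | (∀ i, r (x i) (x (i + 1))) ∧
        Function.IsPeriodicPt shiftMap (k + 1) x} =
      Nat.card {y : ZMod (k + 1) → α // ∀ i, r (y i) (y (i + 1))} := by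
  rw [← Nat.card_coe_set_eq]
  symm
  refine Nat.card_congr (Equiv.ofBijective (fun y => ⟨fun i : ℤ => y.1 i, ?_, ?_⟩) ⟨?_, ?_⟩)
  · intro i
    simpa using y.2 i
  · rw [Function.IsPeriodicPt, Function.IsFixedPt, iterate_shiftMap]
    funext i
    have : ((k + 1 : ℕ) : ZMod (k + 1)) = 0 := ZMod.natCast_self _
    push_cast at this ⊢
    rw [this, add_zero]
  · intro y y' h
    ext z
    obtain ⟨i, rfl⟩ := ZMod.intCast_surjective z
    exact congrFun (congrArg Subtype.val h) i
  · rintro ⟨x, hx, hp⟩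
    rw [Function.IsPeriodicPt, Function.IsFixedPt, iterate_shiftMap] at hp
    have hper : Function.Periodic x ((k + 1 : ℕ) : ℤ) := congrFun hp
    -- By periodicity `x` depends only on residues modulo `k + 1`, so it descends to `ZMod (k + 1)`
    -- through the representatives `val`.
    have hval : ∀ i : ℤ, x ((i : ZMod (k + 1)).val : ℤ) = x i := by
      intro i
      rw [ZMod.val_intCast, Int.emod_def, mul_comm]
      exact hper.sub_int_mul_eq _
    refine ⟨⟨fun z => x z.val, fun z => ?_⟩, Subtype.ext (funext hval)⟩
    obtain ⟨i, rfl⟩ := ZMod.intCast_surjective z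
    have := hval (i + 1)
    push_cast at this
    change r (x _) (x _)
    rw [hval, this]
    exact hx i

/-- A cyclic edge walk is a cyclic sequence of vertices together with a choice of edge for each
consecutive pair. -/
theorem card_cyclic_walks {n : ℕ} (M : Matrix (Fin n) (Fin n) ℕ) (k : ℕ) :
    Nat.card {y : Fin (k + 1) → Edge M // ∀ i, (y i).1.2 = (y (i + 1)).1.1} =
      ∑ v : Fin (k + 1) → Fin n, ∏ i, M (v i) (v (i + 1)) := by
  have h : Nat.card (Σ v : Fin (k + 1) → Fin n, ∀ i, Fin (M (v i) (v (i + 1)))) =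
      ∑ v : Fin (k + 1) → Fin n, ∏ i, M (v i) (v (i + 1)) := by
    simp
  rw [← h]
  symm
  refine Nat.card_congr (Equiv.ofBijective
    (fun p => ⟨fun i => ⟨(p.1 i, p.1 (i + 1)), p.2 i⟩, fun _ => rfl⟩) ⟨?_, ?_⟩)
  · rintro ⟨v, f⟩ ⟨v', f'⟩ h
    have h' := fun i => congrFun (congrArg Subtype.val h) i
    obtain rfl : v = v' := funext fun i => congrArg (fun e : Edge M => e.1.1) (h' i)
    congr
    funext i
    exact eq_of_heq (Sigma.mk.inj (h' i)).2
  · rintro ⟨y, hy⟩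
    have h : ∀ i, ∃ f : Fin (M (y i).1.1 (y (i + 1)).1.1),
        (⟨((y i).1.1, (y (i + 1)).1.1), f⟩ : Edge M) = y i := by
      intro i
      rw [← hy i]
      exact ⟨(y i).2, rfl⟩
    choose f hf using h
    exact ⟨⟨fun i => (y i).1.1, f⟩, Subtype.ext (funext hf)⟩

theorem periodicCount_succ {n : ℕ} (M : Matrix (Fin n) (Fin n) ℕ) (k : ℕ) :
    periodicCount M (k + 1) = (M ^ (k + 1)).trace := by
  rw [trace_pow_succ_eq_sum, ← card_cyclic_walks]
  -- `ZMod (k + 1)` unfolds to `Fin (k + 1)`, with the same cyclic successor.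
  exact card_periodic (fun a b : Edge M => a.1.2 = b.1.1) k

/-! ### The zeta function -/

/-- `ζ (t) = 1 / det (1 - t M)`. -/
theorem zeta_mul_det {n : ℕ} (M : Matrix (Fin n) (Fin n) ℕ) :
    zeta M *
      (1 - (PowerSeries.X : PowerSeries ℚ) • M.map (fun a => (a : PowerSeries ℚ))).det = 1 := by
  have hM : M.map (fun a => (a : PowerSeries ℚ)) =
      (M.map (Nat.cast : ℕ → ℚ)).map (PowerSeries.C (R := ℚ)) := by
    ext1 i j
    simp
  rw [hM]
  set P : PowerSeries ℚ := PowerSeries.mk fun k => (periodicCount M k : ℚ) / k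
  -- Whatever `periodicCount M 0` is, division by `0` makes the constant term zero, so substitution
  -- into `exp` is legitimate.
  have hP0 : PowerSeries.constantCoeff P = 0 := by simp [P]
  have hs : PowerSeries.HasSubst P := PowerSeries.HasSubst.of_constantCoeff_zero' hP0
  have hz : zeta M = (PowerSeries.exp ℚ).subst P := rfl
  have hP' : PowerSeries.derivative ℚ P =
      PowerSeries.mk fun k => (M.map (Nat.cast : ℕ → ℚ) ^ (k + 1)).trace := by
    ext k
    have h : M.map (Nat.cast : ℕ → ℚ) = M.map (Nat.castRingHom ℚ) := rfl
    rw [PowerSeries.coeff_derivative, PowerSeries.coeff_mk, PowerSeries.coeff_mk,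
      periodicCount_succ, h, ← Matrix.map_pow, ← AddMonoidHom.map_trace]
    push_cast
    rw [div_mul_cancel₀ _ (by positivity)]
  -- In characteristic zero a series is determined by its derivative and its constant term. The
  -- logarithmic derivatives of the two factors cancel.
  refine PowerSeries.derivative.ext ?_ ?_
  · rw [Derivation.leibniz, derivative_det_one_sub, hz, PowerSeries.derivative_subst hs,
      PowerSeries.derivative_exp, hP', PowerSeries.derivative_one]
    simp only [smul_eq_mul]
    ring
  · have h1 : PowerSeries.constantCoeff (zeta M) = 1 := by
      have h := PowerSeries.constantCoeff_subst_eq_zero hP0 (PowerSeries.exp ℚ - 1) (by simp)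
      have h2 : (1 : PowerSeries ℚ).subst P = 1 := by
        rw [← PowerSeries.coe_substAlgHom hs, map_one]
      rw [PowerSeries.subst_sub hs, h2, map_sub, map_one, sub_eq_zero] at h
      exact h
    rw [map_mul, h1, one_mul, RingHom.map_det, map_one]
    convert Matrix.det_one (n := Fin n) using 2
    ext1 i j
    simp [Matrix.one_apply, apply_ite]

/-! ### Convergence inside the spectral radius -/

/-- Absolute convergence of a power series at radius `r`. -/
def AbsConv {K : Type*} [NormedField K] (r : ℝ) (P : PowerSeries K) : Prop :=
  Summable fun k => ‖PowerSeries.coeff k P‖ * r ^ k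

theorem AbsConv.mul {K : Type*} [NormedField K] {r : ℝ} (hr : 0 ≤ r) {P Q : PowerSeries K}
    (hP : AbsConv r P) (hQ : AbsConv r Q) : AbsConv r (P * Q) := by
  have hPQ : Summable fun p : ℕ × ℕ => (‖PowerSeries.coeff p.1 P‖ * r ^ p.1) *
      (‖PowerSeries.coeff p.2 Q‖ * r ^ p.2) :=
    Summable.mul_of_nonneg hP hQ (fun k => by positivity) fun k => by positivity
  have h := summable_sum_mul_antidiagonal_of_summable_mul
    (f := fun k => ‖PowerSeries.coeff k P‖ * r ^ k) (g := fun k => ‖PowerSeries.coeff k Q‖ * r ^ k)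
    hPQ
  refine Summable.of_nonneg_of_le (fun k => mul_nonneg (norm_nonneg _) (pow_nonneg hr k))
    (fun k => ?_) h
  rw [PowerSeries.coeff_mul]
  refine (mul_le_mul_of_nonneg_right (norm_sum_le _ _) (by positivity)).trans (le_of_eq ?_)
  rw [Finset.sum_mul]
  refine Finset.sum_congr rfl fun p hp => ?_
  rw [← Finset.HasAntidiagonal.mem_antidiagonal.mp hp, norm_mul, pow_add]
  ring

theorem absConv_coe {K : Type*} [NormedField K] (r : ℝ) (p : K[X]) :
    AbsConv r (p : PowerSeries K) := by
  refine summable_of_ne_finset_zero (s := Finset.range (p.natDegree + 1)) fun k hk => ?_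
  rw [Polynomial.coeff_coe, Polynomial.coeff_eq_zero_of_natDegree_lt (by simpa using hk)]
  simp

theorem tsum_coeff_mul {r : ℝ} (hr : 0 ≤ r) {P Q : PowerSeries ℝ} (hP : AbsConv r P)
    (hQ : AbsConv r Q) :
    (∑' k, PowerSeries.coeff k P * r ^ k) * ∑' k, PowerSeries.coeff k Q * r ^ k =
      ∑' k, PowerSeries.coeff k (P * Q) * r ^ k := by
  have h : ∀ {P : PowerSeries ℝ}, AbsConv r P →
      Summable fun k => ‖PowerSeries.coeff k P * r ^ k‖ := fun hP => by
    simp only [norm_mul, norm_pow, Real.norm_of_nonneg hr]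
    exact hP
  rw [tsum_mul_tsum_eq_tsum_sum_antidiagonal_of_summable_norm (h hP) (h hQ)]
  refine tsum_congr fun k => ?_
  rw [PowerSeries.coeff_mul, Finset.sum_mul]
  refine Finset.sum_congr rfl fun p hp => ?_
  rw [← Finset.HasAntidiagonal.mem_antidiagonal.mp hp, pow_add]
  ring

theorem coe_charpolyRev {R ι : Type*} [CommRing R] [Fintype ι] [DecidableEq ι]
    (N : Matrix ι ι R) :
    (N.charpolyRev : PowerSeries R) =
      (1 - (PowerSeries.X : PowerSeries R) • N.map (PowerSeries.C (R := R))).det := by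
  rw [Matrix.charpolyRev, ← Polynomial.coeToPowerSeries.ringHom_apply, RingHom.map_det]
  congr 1
  ext1 i j
  simp [Matrix.one_apply, apply_ite]
  ring

theorem eval_charpolyRev_eq_det {R ι : Type*} [CommRing R] [Fintype ι] [DecidableEq ι]
    (N : Matrix ι ι R) (r : R) : N.charpolyRev.eval r = (1 - r • N).det := by
  rw [Matrix.charpolyRev, ← Polynomial.coe_evalRingHom, RingHom.map_det]
  congr 1
  ext1 i j
  simp [Matrix.one_apply, apply_ite]
  ring

theorem reverse_X_sub_C {R : Type*} [CommRing R] [IsDomain R] (a : R) :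
    (Polynomial.X - Polynomial.C a).reverse = 1 - Polynomial.C a * Polynomial.X := by
  rw [sub_eq_add_neg, ← Polynomial.C_neg, Polynomial.reverse_add_C]
  have h := Polynomial.reverse_mul_X (1 : R[X])
  rw [one_mul, ← Polynomial.C_1, Polynomial.reverse_C, Polynomial.C_1] at h
  simp [sub_eq_add_neg, h]

/-- Reversal is multiplicative over a domain. Applied to the characteristic polynomial, it factors
`det (1 - t A)` over the eigenvalues; a zero eigenvalue gives the factor `1`. -/
theorem reverse_prod_X_sub_C {R : Type*} [CommRing R] [IsDomain R] (s : Multiset R) :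
    (s.map fun a => Polynomial.X - Polynomial.C a).prod.reverse =
      (s.map fun a => 1 - Polynomial.C a * Polynomial.X).prod := by
  induction s using Multiset.induction_on with
  | empty => simp [Polynomial.reverse]
  | cons a s ih =>
    rw [Multiset.map_cons, Multiset.prod_cons, Polynomial.reverse_mul_of_domain, ih,
      reverse_X_sub_C, Multiset.map_cons, Multiset.prod_cons]

/-- The inverse is a product of geometric series of ratios `a * X`, each absolutely convergent at
radius `r`, and absolute convergence survives Cauchy products. -/
theorem exists_absConv_inverse {K : Type*} [NormedField K] {r : ℝ} (hr : 0 ≤ r) (s : Multiset K)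
    (hs : ∀ a ∈ s, r * ‖a‖ < 1) :
    ∃ Q : PowerSeries K, AbsConv r Q ∧
      Q * (((s.map fun a => 1 - Polynomial.C a * Polynomial.X).prod : K[X]) : PowerSeries K) =
        1 := by
  induction s using Multiset.induction_on with
  | empty => exact ⟨1, by simpa using absConv_coe r (1 : K[X]), by simp⟩
  | cons a s ih =>
    obtain ⟨Q, hQ, hQ'⟩ := ih fun b hb => hs b (Multiset.mem_cons_of_mem hb)
    have ha := hs a (Multiset.mem_cons_self a s)
    have hg : AbsConv r (PowerSeries.mk fun k => a ^ k) := by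
      refine (summable_geometric_of_lt_one (by positivity) ha).congr fun k => ?_
      rw [PowerSeries.coeff_mk, norm_pow, mul_pow, mul_comm]
    have hg' : (PowerSeries.mk fun k => a ^ k) *
        ((1 - Polynomial.C a * Polynomial.X : K[X]) : PowerSeries K) = 1 := by
      ext k
      cases k with
      | zero => simp
      | succ k =>
        have h : (PowerSeries.mk fun k => a ^ k) *
            ((1 - Polynomial.C a * Polynomial.X : K[X]) : PowerSeries K) =
            (PowerSeries.mk fun k => a ^ k) -
              PowerSeries.C a * ((PowerSeries.mk fun k => a ^ k) * PowerSeries.X) := by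
          push_cast
          ring
        rw [h, map_sub, PowerSeries.coeff_C_mul, PowerSeries.coeff_succ_mul_X,
          PowerSeries.coeff_mk, PowerSeries.coeff_mk, PowerSeries.coeff_one,
          if_neg (Nat.succ_ne_zero k), pow_succ', sub_self]
    refine ⟨(PowerSeries.mk fun k => a ^ k) * Q, hg.mul hr hQ, ?_⟩
    rw [Multiset.map_cons, Multiset.prod_cons, Polynomial.coe_mul, mul_mul_mul_comm, hg', hQ',
      one_mul]

/-- The inverse of `det (1 - t A)` converges absolutely at radii `r` with `r * ρ(A) < 1`. -/
theorem absConv_of_mul_charpolyRev {ι : Type*} [Fintype ι] [DecidableEq ι] (A : Matrix ι ι ℂ)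
    (r : ℝ≥0) (h : (r : ℝ≥0∞) * spectralRadius ℂ A < 1) (Q : PowerSeries ℂ)
    (hQ : Q * (A.charpolyRev : PowerSeries ℂ) = 1) : AbsConv (r : ℝ) Q := by
  have hroots : ∀ μ ∈ A.charpoly.roots, (r : ℝ) * ‖μ‖ < 1 := by
    intro μ hμ
    have hμ' : μ ∈ spectrum ℂ A :=
      Matrix.mem_spectrum_iff_isRoot_charpoly.mpr (Polynomial.isRoot_of_mem_roots hμ)
    have h1 : (‖μ‖₊ : ℝ≥0∞) ≤ spectralRadius ℂ A :=
      le_iSup₂ (f := fun μ (_ : μ ∈ spectrum ℂ A) => (‖μ‖₊ : ℝ≥0∞)) μ hμ'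
    have h2 : (r : ℝ≥0∞) * (‖μ‖₊ : ℝ≥0∞) < 1 := (mul_le_mul_right h1 _).trans_lt h
    exact_mod_cast h2
  obtain ⟨Q', hQ', hQ''⟩ := exists_absConv_inverse r.coe_nonneg _ hroots
  have hs := (IsAlgClosed.splits A.charpoly).eq_prod_roots_of_monic A.charpoly_monic
  rw [← reverse_prod_X_sub_C, ← hs, Matrix.reverse_charpoly] at hQ''
  -- Inverses are unique, so the given `Q` is the convergent product just constructed.
  rwa [left_inv_eq_right_inv hQ ((mul_comm _ _).trans hQ'')]

/-- Inside the radius of convergence, `∑ₖ cₖ r ^ k = 1 / det (1 - r M)`. -/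
theorem evalSeries_eq_inverse_det {n : ℕ} (M : Matrix (Fin n) (Fin n) ℕ) (Z : PowerSeries ℕ)
    (hZ : PowerSeries.map (Nat.castRingHom ℚ) Z *
      (1 - (PowerSeries.X : PowerSeries ℚ) • M.map (fun a => (a : PowerSeries ℚ))).det = 1)
    (r : ℝ≥0)
    (h : (r : ℝ≥0∞) * spectralRadius ℂ (M.map (fun a => (a : ℂ))) < 1) :
    0 < (1 - (r : ℝ) • M.map (fun a => (a : ℝ))).det ∧
    evalSeries r Z = ENNReal.ofReal (1 / (1 - (r : ℝ) • M.map (fun a => (a : ℝ))).det) := by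
  -- Natural coefficients let the identity over `ℚ` move to any field of characteristic zero: `ℂ` to
  -- use eigenvalues, `ℝ` to evaluate.
  have hK : ∀ {K : Type} [Field K] [CharZero K], PowerSeries.map (Nat.castRingHom K) Z *
      ((M.map (Nat.cast : ℕ → K)).charpolyRev : PowerSeries K) = 1 := by
    intro K _ _
    have h := congrArg (PowerSeries.map (algebraMap ℚ K)) hZ
    rw [map_mul, map_one, RingHom.map_det] at h
    rw [coe_charpolyRev, ← h]
    congr 1
    · ext k
      simp
    · congr 1
      ext1 i j
      simp [Matrix.one_apply, apply_ite]
  have hC : AbsConv (r : ℝ) (PowerSeries.map (Nat.castRingHom ℝ) Z) := by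
    have := absConv_of_mul_charpolyRev _ r h _ hK
    simpa [AbsConv] using this
  have hmul := tsum_coeff_mul r.coe_nonneg hC (absConv_coe _ (M.map (Nat.cast : ℕ → ℝ)).charpolyRev)
  have hdet : ∑' k, PowerSeries.coeff k
      ((M.map (Nat.cast : ℕ → ℝ)).charpolyRev : PowerSeries ℝ) * (r : ℝ) ^ k =
      (1 - (r : ℝ) • M.map (fun a => (a : ℝ))).det := by
    rw [← eval_charpolyRev_eq_det, Polynomial.eval_eq_sum_range, tsum_eq_sum
      (s := Finset.range ((M.map (Nat.cast : ℕ → ℝ)).charpolyRev.natDegree + 1))]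
    · simp only [Polynomial.coeff_coe]
    · intro k hk
      rw [Polynomial.coeff_coe, Polynomial.coeff_eq_zero_of_natDegree_lt (by simpa using hk),
        zero_mul]
  have hone : ∑' k, PowerSeries.coeff k (1 : PowerSeries ℝ) * (r : ℝ) ^ k = 1 := by
    rw [tsum_eq_single 0]
    · simp
    · intro k hk
      rw [PowerSeries.coeff_one, if_neg hk, zero_mul]
  rw [hK, hdet, hone] at hmul
  have hsum : Summable fun k =>
      PowerSeries.coeff k (PowerSeries.map (Nat.castRingHom ℝ) Z) * (r : ℝ) ^ k := by
    simpa [AbsConv] using hC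
  have hnn : ∀ k, 0 ≤ PowerSeries.coeff k (PowerSeries.map (Nat.castRingHom ℝ) Z) * (r : ℝ) ^ k :=
    fun k => by simp only [PowerSeries.coeff_map, eq_natCast]; positivity
  -- The determinant times a sum of nonnegative terms equals `1`, so it must be positive.
  have hpos : 0 < (1 - (r : ℝ) • M.map (fun a => (a : ℝ))).det :=
    pos_of_mul_pos_right (by rw [hmul]; exact one_pos) (tsum_nonneg hnn)
  refine ⟨hpos, ?_⟩
  rw [one_div, ← eq_inv_of_mul_eq_one_left hmul, ENNReal.ofReal_tsum_of_nonneg hnn hsum,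
    evalSeries_apply]
  refine tsum_congr fun k => ?_
  rw [ENNReal.ofReal_mul (by simp), ENNReal.ofReal_pow r.coe_nonneg, ENNReal.ofReal_coe_nnreal]
  simp

/-! ### Generators of the prop of matrices over `ℕ[t]` -/

theorem directSum_apply_castAdd_castAdd {n m n' m' : ℕ} (A : Matrix (Fin m) (Fin n) ℕ[X])
    (B : Matrix (Fin m') (Fin n') ℕ[X]) (i : Fin m) (j : Fin n) :
    directSum A B (Fin.castAdd m' i) (Fin.castAdd n' j) = A i j := by
  simp [directSum]

theorem directSum_apply_castAdd_natAdd {n m n' m' : ℕ} (A : Matrix (Fin m) (Fin n) ℕ[X])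
    (B : Matrix (Fin m') (Fin n') ℕ[X]) (i : Fin m) (j : Fin n') :
    directSum A B (Fin.castAdd m' i) (Fin.natAdd n j) = 0 := by
  simp [directSum]

theorem directSum_apply_natAdd_castAdd {n m n' m' : ℕ} (A : Matrix (Fin m) (Fin n) ℕ[X])
    (B : Matrix (Fin m') (Fin n') ℕ[X]) (i : Fin m') (j : Fin n) :
    directSum A B (Fin.natAdd m i) (Fin.castAdd n' j) = 0 := by
  simp [directSum]

theorem directSum_apply_natAdd_natAdd {n m n' m' : ℕ} (A : Matrix (Fin m) (Fin n) ℕ[X])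
    (B : Matrix (Fin m') (Fin n') ℕ[X]) (i : Fin m') (j : Fin n') :
    directSum A B (Fin.natAdd m i) (Fin.natAdd n j) = B i j := by
  simp [directSum]

theorem directSum_one_one (n m : ℕ) :
    directSum (1 : Matrix (Fin n) (Fin n) ℕ[X]) (1 : Matrix (Fin m) (Fin m) ℕ[X]) = 1 := by
  rw [directSum, Matrix.fromBlocks_one, Matrix.reindex_apply, Matrix.submatrix_one_equiv]

/-- Permutation matrices over `ℕ[t]`. -/
def permMat {n : ℕ} (σ : Equiv.Perm (Fin n)) : Matrix (Fin n) (Fin n) ℕ[X] :=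
  (1 : Matrix (Fin n) (Fin n) ℕ[X]).submatrix σ id

theorem permMat_mul {n m : ℕ} (σ : Equiv.Perm (Fin m)) (A : Matrix (Fin m) (Fin n) ℕ[X]) :
    permMat σ * A = A.submatrix σ id := by
  ext1 i j
  simp [permMat, Matrix.mul_apply, Matrix.one_apply]

theorem mul_permMat {n m : ℕ} (σ : Equiv.Perm (Fin n)) (A : Matrix (Fin m) (Fin n) ℕ[X]) :
    A * permMat σ = A.submatrix id σ.symm := by
  ext1 i j
  simp [permMat, Matrix.mul_apply, Matrix.one_apply, ← Equiv.eq_symm_apply]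

/-- An adjacent transposition fixing the last index is a smaller one plus an idle wire. With
`permMat_swap_last`, this builds all adjacent transpositions from the symmetry by induction. -/
theorem permMat_swap_castSucc {n : ℕ} (i : Fin n) :
    permMat (Equiv.swap i.castSucc.castSucc i.castSucc.succ) =
      directSum (permMat (Equiv.swap i.castSucc i.succ)) (1 : Matrix (Fin 1) (Fin 1) ℕ[X]) := by
  have h1 : ∀ z : Fin (n + 1), Equiv.swap i.castSucc.castSucc i.castSucc.succ z.castSucc =
      (Equiv.swap i.castSucc i.succ z).castSucc := by
    intro z
    rw [Fin.succ_castSucc, Equiv.swap_apply_def, Equiv.swap_apply_def]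
    simp only [Fin.castSucc_inj]
    split_ifs <;> rfl
  have h2 : Equiv.swap i.castSucc.castSucc i.castSucc.succ (Fin.last (n + 1)) =
      Fin.last (n + 1) := by
    refine Equiv.swap_apply_of_ne_of_ne (Fin.castSucc_lt_last _).ne' ?_
    rw [Fin.succ_castSucc]
    exact (Fin.castSucc_lt_last _).ne'
  ext1 x y
  rw [permMat, Matrix.submatrix_apply, id_eq]
  refine Fin.lastCases ?_ (fun x => ?_) x
  · rw [h2]
    refine Fin.lastCases ?_ (fun y => ?_) y
    · rw [Matrix.one_apply_eq]
      exact ((directSum_apply_natAdd_natAdd (permMat _) 1 0 0).trans (Matrix.one_apply_eq 0)).symm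
    · rw [Matrix.one_apply_ne (Fin.castSucc_lt_last _).ne']
      exact (directSum_apply_natAdd_castAdd (permMat _) 1 0 y).symm
  · rw [h1]
    refine Fin.lastCases ?_ (fun y => ?_) y
    · rw [Matrix.one_apply_ne (Fin.castSucc_lt_last _).ne]
      exact (directSum_apply_castAdd_natAdd (permMat _) 1 x 0).symm
    · refine Eq.trans ?_ (directSum_apply_castAdd_castAdd (permMat _) 1 x y).symm
      rw [permMat, Matrix.submatrix_apply, id_eq, Matrix.one_apply, Matrix.one_apply]
      simp only [Fin.castSucc_inj]

theorem permMat_swap_last (n : ℕ) :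
    permMat (Equiv.swap (Fin.last n).castSucc (Fin.last n).succ) =
      directSum (1 : Matrix (Fin n) (Fin n) ℕ[X])
        (!![0, 1; 1, 0] : Matrix (Fin 2) (Fin 2) ℕ[X]) := by
  have ha : (Fin.last n).castSucc = Fin.natAdd n (0 : Fin 2) := rfl
  have hb : (Fin.last n).succ = Fin.natAdd n (1 : Fin 2) := rfl
  rw [ha, hb]
  have h1 : ∀ z : Fin n, Equiv.swap (Fin.natAdd n (0 : Fin 2)) (Fin.natAdd n (1 : Fin 2))
      (Fin.castAdd 2 z) = Fin.castAdd 2 z := fun z =>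
    Equiv.swap_apply_of_ne_of_ne (fun h => by simpa [Fin.ext_iff] using z.2.ne (congrArg Fin.val h))
      (fun h => by have := congrArg Fin.val h; simp at this; omega)
  ext1 x y
  rw [permMat, Matrix.submatrix_apply, id_eq]
  refine Fin.addCases (m := n) (n := 2) (fun x => ?_) (fun x => ?_) x
  · rw [h1]
    refine Fin.addCases (m := n) (n := 2) (fun y => ?_) (fun y => ?_) y
    · rw [directSum_apply_castAdd_castAdd, Matrix.one_apply, Matrix.one_apply]
      simp only [Fin.castAdd_inj]
    · rw [directSum_apply_castAdd_natAdd, Matrix.one_apply_ne]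
      intro h
      have := congrArg Fin.val h
      simp at this
      omega
  · have h2 : Equiv.swap (Fin.natAdd n (0 : Fin 2)) (Fin.natAdd n (1 : Fin 2)) (Fin.natAdd n x) =
        Fin.natAdd n (Equiv.swap 0 1 x) := by
      fin_cases x
      · exact Equiv.swap_apply_left _ _
      · exact Equiv.swap_apply_right _ _
    rw [h2]
    refine Fin.addCases (m := n) (n := 2) (fun y => ?_) (fun y => ?_) y
    · rw [directSum_apply_natAdd_castAdd, Matrix.one_apply_ne]
      intro h
      have := congrArg Fin.val h
      simp at this
      omega
    · rw [directSum_apply_natAdd_natAdd, Matrix.one_apply]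
      simp only [Fin.natAdd_inj]
      fin_cases x <;> fin_cases y <;> rfl

/-! ### Prop functors that agree on the generators -/

/-- Two functors agree on a matrix with arbitrary finite index types if they agree on it for every
numbering of the index types. -/
def Agree (F G : PropFunctor) {α β : Type} (A : Matrix α β ℕ[X]) : Prop :=
  ∀ (m n : ℕ) (e : α ≃ Fin m) (f : β ≃ Fin n),
    F.map (Matrix.reindex e f A) = G.map (Matrix.reindex e f A)

section

variable {F G : PropFunctor}

/-- `PropFunctor` only prescribes the identities of sizes `0` and `1`; the others are direct sums of
these. -/
theorem map_one_eq (n : ℕ) :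
    F.map (1 : Matrix (Fin n) (Fin n) ℕ[X]) = G.map (1 : Matrix (Fin n) (Fin n) ℕ[X]) := by
  induction n with
  | zero => rw [F.map_empty, G.map_empty]
  | succ n ih => rw [← directSum_one_one, F.map_tensor, G.map_tensor, ih, F.map_ident, G.map_ident]

theorem map_permMat_swap (n : ℕ) (i : Fin n) :
    F.map (permMat (Equiv.swap i.castSucc i.succ)) =
      G.map (permMat (Equiv.swap i.castSucc i.succ)) := by
  induction n with
  | zero => exact i.elim0
  | succ n ih =>
    refine Fin.lastCases ?_ (fun i => ?_) i
    · rw [permMat_swap_last, F.map_tensor, G.map_tensor, map_one_eq (F := F) (G := G), F.map_symm,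
        G.map_symm]
    · rw [permMat_swap_castSucc, F.map_tensor, G.map_tensor, ih, F.map_ident, G.map_ident]

/-- Adjacent transpositions generate the symmetric group as a monoid. -/
theorem map_permMat {n : ℕ} (σ : Equiv.Perm (Fin n)) :
    F.map (permMat σ) = G.map (permMat σ) := by
  cases n with
  | zero => rw [Subsingleton.elim (permMat σ) 1, F.map_empty, G.map_empty]
  | succ n =>
    have hσ : σ ∈ Submonoid.closure
        (Set.range fun i : Fin n => Equiv.swap i.castSucc i.succ) := by
      rw [Equiv.Perm.mclosure_swap_castSucc_succ]
      trivial
    induction hσ using Submonoid.closure_induction with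
    | mem σ h =>
      obtain ⟨i, rfl⟩ := h
      exact map_permMat_swap n i
    | one =>
      have h : permMat (1 : Equiv.Perm (Fin (n + 1))) = 1 := rfl
      rw [h, map_one_eq]
    | mul σ τ _ _ hσ hτ =>
      -- Permuting rows by precomposition reverses the order of products.
      have h : permMat (σ * τ) = permMat τ * permMat σ := by
        rw [permMat_mul]
        rfl
      rw [h, F.map_comp, G.map_comp, hσ, hτ]

/-- Two numberings differ by permutation matrices on each side, where the functors already agree, so
one numbering suffices. -/
theorem Agree.of_equiv {α β : Type} {A : Matrix α β ℕ[X]} {m n : ℕ} (e : α ≃ Fin m) (f : β ≃ Fin n)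
    (h : F.map (Matrix.reindex e f A) = G.map (Matrix.reindex e f A)) : Agree F G A := by
  intro m' n' e' f'
  obtain rfl : m' = m := by simpa using Fintype.card_congr (e'.symm.trans e)
  obtain rfl : n' = n := by simpa using Fintype.card_congr (f'.symm.trans f)
  have hA : Matrix.reindex e' f' A =
      permMat (e'.symm.trans e) * (Matrix.reindex e f A * permMat (f.symm.trans f')) := by
    rw [mul_permMat, permMat_mul]
    ext1 i j
    simp
  rw [hA, F.map_comp, G.map_comp, F.map_comp, G.map_comp, h, map_permMat (F := F) (G := G),
    map_permMat (F := F) (G := G)]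

theorem agree_iff {m n : ℕ} {A : Matrix (Fin m) (Fin n) ℕ[X]} :
    Agree F G A ↔ F.map A = G.map A :=
  ⟨fun h => h m n (Equiv.refl _) (Equiv.refl _), Agree.of_equiv (Equiv.refl _) (Equiv.refl _)⟩

theorem Agree.submatrix {α β α' β' : Type} {A : Matrix α β ℕ[X]} (h : Agree F G A) (e : α' ≃ α)
    (f : β' ≃ β) : Agree F G (A.submatrix e f) :=
  fun m n e' f' => h m n (e.symm.trans e') (f.symm.trans f')

theorem Agree.mul {α β γ : Type} [Fintype α] [Fintype β] [Fintype γ] {A : Matrix α β ℕ[X]}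
    {B : Matrix β γ ℕ[X]} (hA : Agree F G A) (hB : Agree F G B) : Agree F G (A * B) := by
  intro m n e f
  have h : Matrix.reindex e f (A * B) =
      Matrix.reindex e (Fintype.equivFin β) A * Matrix.reindex (Fintype.equivFin β) f B :=
    (Matrix.submatrix_mul_equiv A B _ _ _).symm
  rw [h, F.map_comp, G.map_comp, hA, hB]

theorem Agree.fromBlocks {α β α' β' : Type} [Fintype α] [Fintype β] [Fintype α'] [Fintype β']
    {A : Matrix α β ℕ[X]} {B : Matrix α' β' ℕ[X]} (hA : Agree F G A) (hB : Agree F G B) :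
    Agree F G (Matrix.fromBlocks A 0 0 B) := by
  refine Agree.of_equiv
    (((Fintype.equivFin α).sumCongr (Fintype.equivFin α')).trans finSumFinEquiv)
    (((Fintype.equivFin β).sumCongr (Fintype.equivFin β')).trans finSumFinEquiv) ?_
  have h : Matrix.reindex
      (((Fintype.equivFin α).sumCongr (Fintype.equivFin α')).trans finSumFinEquiv)
      (((Fintype.equivFin β).sumCongr (Fintype.equivFin β')).trans finSumFinEquiv)
      (Matrix.fromBlocks A 0 0 B) =
      directSum (Matrix.reindex (Fintype.equivFin α) (Fintype.equivFin β) A)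
        (Matrix.reindex (Fintype.equivFin α') (Fintype.equivFin β') B) := by
    ext1 i j
    refine Fin.addCases (fun i => ?_) (fun i => ?_) i <;>
      refine Fin.addCases (fun j => ?_) (fun j => ?_) j <;> simp [directSum]
  rw [h, F.map_tensor, G.map_tensor, hA, hB]

/-- The copying matrix `(1; 1)` on an arbitrary index type. -/
def copyMat (α : Type) [DecidableEq α] : Matrix (α ⊕ α) α ℕ[X] :=
  Matrix.fromRows 1 1

/-- Copying a pair is copying each component and then exchanging the two middle blocks. -/
theorem copyMat_sum (α β : Type) [DecidableEq α] [DecidableEq β] :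
    copyMat (α ⊕ β) = (Matrix.fromBlocks (copyMat α) 0 0 (copyMat β)).submatrix
      (Equiv.sumSumSumComm α β α β) (Equiv.refl _) := by
  ext1 i j
  rcases i with (i | i) | (i | i) <;> rcases j with j | j <;>
    simp [copyMat, Matrix.one_apply]

theorem copyMat_equiv {α β : Type} [DecidableEq α] [DecidableEq β] (e : α ≃ β) :
    copyMat α = (copyMat β).submatrix (e.sumCongr e) e := by
  ext1 i j
  rcases i with i | i <;> simp [copyMat, Matrix.one_apply]

end

/-! ### Uniqueness of the interpretation -/

section

variable {F G : PropFunctor} {lam : ℝ≥0∞}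

/-- Polynomials are generated by `t` under sums and products: `p + q` is `μ ∘ (p ⊕ q) ∘ Δ`, `p * q`
is a composite, `0` is `η ∘ ε` and `1` is the wire. -/
theorem map_scalar_eq (hF : F.IsBinomial lam) (hG : G.IsBinomial lam) (p : ℕ[X]) :
    F.map (!![p] : Matrix (Fin 1) (Fin 1) ℕ[X]) = G.map !![p] := by
  have hadd : ∀ p q : ℕ[X], F.map (!![p] : Matrix (Fin 1) (Fin 1) ℕ[X]) = G.map !![p] →
      F.map (!![q] : Matrix (Fin 1) (Fin 1) ℕ[X]) = G.map !![q] →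
      F.map (!![p + q] : Matrix (Fin 1) (Fin 1) ℕ[X]) = G.map !![p + q] := by
    intro p q hp hq
    have h : (!![p + q] : Matrix (Fin 1) (Fin 1) ℕ[X]) =
        (!![1, 1] : Matrix (Fin 1) (Fin 2) ℕ[X]) *
          ((directSum !![p] !![q] : Matrix (Fin 2) (Fin 2) ℕ[X]) *
            (!![1; 1] : Matrix (Fin 2) (Fin 1) ℕ[X])) := by
      have h00 : directSum !![p] !![q] (0 : Fin 2) (0 : Fin 2) = p :=
        directSum_apply_castAdd_castAdd !![p] !![q] 0 0
      have h01 : directSum !![p] !![q] (0 : Fin 2) (1 : Fin 2) = 0 :=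
        directSum_apply_castAdd_natAdd !![p] !![q] 0 0
      have h10 : directSum !![p] !![q] (1 : Fin 2) (0 : Fin 2) = 0 :=
        directSum_apply_natAdd_castAdd !![p] !![q] 0 0
      have h11 : directSum !![p] !![q] (1 : Fin 2) (1 : Fin 2) = q :=
        directSum_apply_natAdd_natAdd !![p] !![q] 0 0
      ext1 i j
      fin_cases i; fin_cases j
      simp [Matrix.mul_apply, Fin.sum_univ_two, h00, h01, h10, h11]
    rw [h, F.map_comp, G.map_comp, F.map_comp, G.map_comp, hF.map_mul, hG.map_mul, hF.map_comul,
      hG.map_comul]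
    congr 2
    exact (F.map_tensor _ _).trans ((congrArg₂ tensor hp hq).trans (G.map_tensor _ _).symm)
  have hmul : ∀ p q : ℕ[X], F.map (!![p] : Matrix (Fin 1) (Fin 1) ℕ[X]) = G.map !![p] →
      F.map (!![q] : Matrix (Fin 1) (Fin 1) ℕ[X]) = G.map !![q] →
      F.map (!![p * q] : Matrix (Fin 1) (Fin 1) ℕ[X]) = G.map !![p * q] := by
    intro p q hp hq
    have h : (!![p * q] : Matrix (Fin 1) (Fin 1) ℕ[X]) = !![p] * !![q] := by
      ext1 i j
      fin_cases i; fin_cases j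
      simp [Matrix.mul_apply]
    rw [h, F.map_comp, G.map_comp, hp, hq]
  have hone : F.map (!![1] : Matrix (Fin 1) (Fin 1) ℕ[X]) = G.map !![1] := by
    have h : (!![1] : Matrix (Fin 1) (Fin 1) ℕ[X]) = 1 := by
      ext1 i j
      fin_cases i; fin_cases j
      rfl
    rw [h, F.map_ident, G.map_ident]
  have hzero : F.map (!![0] : Matrix (Fin 1) (Fin 1) ℕ[X]) = G.map !![0] := by
    have h : (!![0] : Matrix (Fin 1) (Fin 1) ℕ[X]) =
        (0 : Matrix (Fin 1) (Fin 0) ℕ[X]) * (0 : Matrix (Fin 0) (Fin 1) ℕ[X]) := by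
      ext1 i j
      fin_cases i; fin_cases j
      simp
    rw [h, F.map_comp, G.map_comp, hF.map_unit, hG.map_unit, hF.map_counit, hG.map_counit]
  have hC : ∀ n : ℕ, F.map (!![Polynomial.C n] : Matrix (Fin 1) (Fin 1) ℕ[X]) =
      G.map !![Polynomial.C n] := by
    intro n
    induction n with
    | zero => rwa [map_zero]
    | succ n ih =>
      rw [map_add, map_one]
      exact hadd _ _ ih hone
  induction p using Polynomial.induction_on with
  | C a => exact hC a
  | add p q hp hq => exact hadd p q hp hq
  | monomial n a h =>
    rw [pow_succ, ← mul_assoc]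
    exact hmul _ _ h (hF.map_scale.trans hG.map_scale.symm)

/-- Split off the last entry: the row is `μ ∘ (A' ⊕ p)`, and the empty row is `η`. -/
theorem map_row_eq (hF : F.IsBinomial lam) (hG : G.IsBinomial lam) {n : ℕ}
    (A : Matrix (Fin 1) (Fin n) ℕ[X]) : F.map A = G.map A := by
  induction n with
  | zero => rw [Subsingleton.elim A 0, hF.map_unit, hG.map_unit]
  | succ n ih =>
    let A' : Matrix (Fin 1) (Fin n) ℕ[X] := A.submatrix id Fin.castSucc
    let p : Matrix (Fin 1) (Fin 1) ℕ[X] := !![A 0 (Fin.last n)]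
    have h : A = (!![1, 1] : Matrix (Fin 1) (Fin 2) ℕ[X]) *
        (directSum A' p : Matrix (Fin 2) (Fin (n + 1)) ℕ[X]) := by
      ext1 i j
      fin_cases i
      rw [Matrix.mul_apply, Fin.sum_univ_two]
      refine Fin.lastCases ?_ (fun j => ?_) j
      · have h0 : directSum A' p (0 : Fin 2) (Fin.last n) = 0 :=
          directSum_apply_castAdd_natAdd A' p 0 0
        have h1 : directSum A' p (1 : Fin 2) (Fin.last n) = A 0 (Fin.last n) :=
          directSum_apply_natAdd_natAdd A' p 0 0
        simp [h0, h1]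
      · have h0 : directSum A' p (0 : Fin 2) j.castSucc = A 0 j.castSucc :=
          directSum_apply_castAdd_castAdd A' p 0 j
        have h1 : directSum A' p (1 : Fin 2) j.castSucc = 0 :=
          directSum_apply_natAdd_castAdd A' p 0 j
        simp [h0, h1]
    rw [h, F.map_comp, G.map_comp, hF.map_mul, hG.map_mul]
    congr 1
    exact (F.map_tensor _ _).trans
      ((congrArg₂ tensor (ih A') (map_scalar_eq hF hG _)).trans (G.map_tensor _ _).symm)

theorem agree_copyMat (hF : F.IsBinomial lam) (hG : G.IsBinomial lam) (n : ℕ) :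
    Agree F G (copyMat (Fin n)) := by
  induction n with
  | zero =>
    refine Agree.of_equiv (m := 0) (n := 0) (Equiv.equivOfIsEmpty _ _) (Equiv.refl _) ?_
    rw [Subsingleton.elim (Matrix.reindex _ _ _) 1, F.map_empty, G.map_empty]
  | succ n ih =>
    rw [copyMat_equiv (finSumFinEquiv (m := n) (n := 1)).symm, copyMat_sum]
    refine Agree.submatrix (Agree.submatrix (Agree.fromBlocks ih ?_) _ _) _ _
    refine Agree.of_equiv (m := 2) (n := 1) finSumFinEquiv (Equiv.refl _) ?_
    have h : Matrix.reindex (finSumFinEquiv (m := 1) (n := 1)) (Equiv.refl _) (copyMat (Fin 1)) =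
        (!![1; 1] : Matrix (Fin 2) (Fin 1) ℕ[X]) := by
      ext1 i j
      fin_cases i <;> fin_cases j <;> rfl
    exact (congrArg F.map h).trans
      ((hF.map_comul.trans hG.map_comul.symm).trans (congrArg G.map h).symm)

theorem map_discard_eq (hF : F.IsBinomial lam) (hG : G.IsBinomial lam) (n : ℕ) :
    F.map (0 : Matrix (Fin 0) (Fin n) ℕ[X]) = G.map (0 : Matrix (Fin 0) (Fin n) ℕ[X]) := by
  induction n with
  | zero => rw [Subsingleton.elim (0 : Matrix (Fin 0) (Fin 0) ℕ[X]) 1, F.map_empty, G.map_empty]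
  | succ n ih =>
    have h : (0 : Matrix (Fin 0) (Fin (n + 1)) ℕ[X]) =
        directSum (0 : Matrix (Fin 0) (Fin n) ℕ[X]) (0 : Matrix (Fin 0) (Fin 1) ℕ[X]) :=
      Subsingleton.elim _ _
    rw [h]
    exact (F.map_tensor _ _).trans ((congrArg₂ tensor ih
      (hF.map_counit.trans hG.map_counit.symm)).trans (G.map_tensor _ _).symm)

/-- Split off the last row: copy all inputs, then apply the upper rows to one copy and the last row
to the other. -/
theorem map_eq_of_isBinomial (hF : F.IsBinomial lam) (hG : G.IsBinomial lam) {m n : ℕ}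
    (A : Matrix (Fin m) (Fin n) ℕ[X]) : F.map A = G.map A := by
  induction m with
  | zero => rw [Subsingleton.elim A 0, map_discard_eq hF hG]
  | succ m ih =>
    let A' : Matrix (Fin m) (Fin n) ℕ[X] := A.submatrix Fin.castSucc id
    let r : Matrix (Fin 1) (Fin n) ℕ[X] := A.submatrix (fun _ => Fin.last m) id
    have h : A = (Matrix.fromBlocks A' 0 0 r * copyMat (Fin n)).submatrix
        (finSumFinEquiv (m := m) (n := 1)).symm (Equiv.refl _) := by
      rw [copyMat, Matrix.fromBlocks_mul_fromRows]
      ext1 i j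
      refine Fin.addCases (m := m) (n := 1) (fun i => ?_) (fun i => ?_) i
      · simp [A']
        rfl
      · fin_cases i
        simp [r]
        rfl
    rw [← agree_iff, h]
    exact Agree.submatrix (Agree.mul
      (Agree.fromBlocks (agree_iff.mpr (ih A')) (agree_iff.mpr (map_row_eq hF hG r)))
      (agree_copyMat hF hG n)) _ _

theorem PropFunctor.IsBinomial.eq_substFunctor (hF : F.IsBinomial lam) : F = substFunctor lam := by
  ext1
  funext n m A
  exact map_eq_of_isBinomial hF (substFunctor_isBinomial lam) A

end

/-! ### Invariance under strong shift equivalence -/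

theorem zeta_eq_of_det_eq {n m : ℕ} (M : Matrix (Fin n) (Fin n) ℕ) (N : Matrix (Fin m) (Fin m) ℕ)
    (h : (1 - (PowerSeries.X : PowerSeries ℚ) • M.map (fun a => (a : PowerSeries ℚ))).det =
      (1 - (PowerSeries.X : PowerSeries ℚ) • N.map (fun a => (a : PowerSeries ℚ))).det) :
    zeta M = zeta N :=
  left_inv_eq_right_inv (zeta_mul_det M) (by rw [h, mul_comm, zeta_mul_det])

/-- Sylvester's identity `det (1 - P Q) = det (1 - Q P)` with `P = t R` and `Q = S`. -/
theorem zeta_mul_comm {n m : ℕ} (R : Matrix (Fin n) (Fin m) ℕ) (S : Matrix (Fin m) (Fin n) ℕ) :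
    zeta (R * S) = zeta (S * R) := by
  refine zeta_eq_of_det_eq _ _ ?_
  have h : ∀ {a b : ℕ} (R : Matrix (Fin a) (Fin b) ℕ) (S : Matrix (Fin b) (Fin a) ℕ),
      (R * S).map (fun a => (a : PowerSeries ℚ)) =
        R.map (Nat.castRingHom (PowerSeries ℚ)) * S.map (Nat.castRingHom (PowerSeries ℚ)) :=
    fun R S => Matrix.map_mul (f := Nat.castRingHom (PowerSeries ℚ))
  rw [h, h, ← Matrix.smul_mul, Matrix.det_one_sub_mul_comm, Matrix.mul_smul]

theorem StrongShiftEquiv.zeta_eq {n m : ℕ} {M : Matrix (Fin n) (Fin n) ℕ}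
    {N : Matrix (Fin m) (Fin m) ℕ} (h : StrongShiftEquiv M N) : zeta M = zeta N := by
  have h' : ∀ p q : Σ n : ℕ, Matrix (Fin n) (Fin n) ℕ,
      Relation.EqvGen ElementaryEquiv p q → zeta p.2 = zeta q.2 := by
    intro p q h
    induction h with
    | rel _ _ h =>
      obtain ⟨R, S⟩ := h
      exact zeta_mul_comm R S
    | refl => rfl
    | symm _ _ _ ih => exact ih.symm
    | trans _ _ _ _ _ ih1 ih2 => exact ih1.trans ih2
  exact h' ⟨n, M⟩ ⟨m, N⟩ h

end BinomialProp

end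

theorem mainTheorem5 :
    (∀ lam : ℝ≥0∞, ∃! F : BinomialProp.PropFunctor, F.IsBinomial lam) ∧
    (∀ (n : ℕ) (M : Matrix (Fin n) (Fin n) ℕ),
      BinomialProp.zeta M *
          (1 - (PowerSeries.X : PowerSeries ℚ) • M.map (fun a => (a : PowerSeries ℚ))).det = 1 ∧
      (∀ k : ℕ, 0 ≤ PowerSeries.coeff k (BinomialProp.zeta M)) ∧
      (∀ (lam : ℝ≥0∞) (F : BinomialProp.PropFunctor), F.IsBinomial lam →
        F.interpret M =
          ∑' k : ℕ, ENNReal.ofReal (PowerSeries.coeff k (BinomialProp.zeta M) : ℚ) * lam ^ k) ∧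
      (∀ (lam : ℝ≥0) (F : BinomialProp.PropFunctor), F.IsBinomial lam →
        (lam : ℝ≥0∞) * spectralRadius ℂ (M.map (fun a => (a : ℂ))) < 1 →
        0 < (1 - (lam : ℝ) • M.map (fun a => (a : ℝ))).det ∧
        F.interpret M =
          ENNReal.ofReal (1 / (1 - (lam : ℝ) • M.map (fun a => (a : ℝ))).det))) ∧
    (∀ (n m : ℕ) (M : Matrix (Fin n) (Fin n) ℕ) (N : Matrix (Fin m) (Fin m) ℕ),
      BinomialProp.StrongShiftEquiv M N → BinomialProp.zeta M = BinomialProp.zeta N) := by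
  refine ⟨fun lam => ⟨BinomialProp.substFunctor lam, BinomialProp.substFunctor_isBinomial lam,
    fun F hF => hF.eq_substFunctor⟩, fun n M => ?_, fun n m M N h => h.zeta_eq⟩
  obtain ⟨Z, hZ, hZ'⟩ := BinomialProp.exists_inverse_det_eq_trace M
  -- Both series invert `det (1 - t M)`, so the coefficients of zeta are the natural numbers that
  -- evaluate to the trace.
  have hzeta : BinomialProp.zeta M = PowerSeries.map (Nat.castRingHom ℚ) Z :=
    left_inv_eq_right_inv (BinomialProp.zeta_mul_det M) ((mul_comm _ _).trans hZ)
  refine ⟨BinomialProp.zeta_mul_det M, fun k => ?_, fun lam F hF => ?_, fun lam F hF h => ?_⟩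
  · rw [hzeta, PowerSeries.coeff_map]
    exact Nat.cast_nonneg _
  · rw [hF.eq_substFunctor, hZ', BinomialProp.evalSeries_apply, hzeta]
    simp
  · rw [hF.eq_substFunctor, hZ']
    exact BinomialProp.evalSeries_eq_inverse_det M Z hZ lam h
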